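/- Variables range over a countably infinite set. A theory is the class of all interpretations (with nonempty domain and with values for all variables) of a set of first-order sentences with equality, its axioms; a formula is $T$-satisfiable if some interpretation in $T$ satisfies it. A theory $T$ is *decidable* if the set of $T$-satisfiable quantifier-free formulas is decidable. $T$ has the *finite model property* if every quantifier-free formula satisfied by some interpretation in $T$ is satisfied by a finite one in $T$. A *minimal model function* of $T$ is a function $m$ from the quantifier-free formulas to $\mathbb N\cup\{\aleph_0\}$ such that, for every $T$-satisfiable quantifier-free $\varphi$, some interpretation in $T$ satisfying $\varphi$ has a domain of cardinality $m(\varphi)$, and every interpretation in $T$ satisfying $\varphi$ has a domain of cardinality at least $m(\varphi)$. $T$ is *smooth* if, whenever $\varphi$ is quantifier-free, $\mathcal A$ is an interpretation in $T$ satisfying $\varphi$, and $\kappa>|\mathcal A|$ is a cardinal, some interpretation in $T$ with a domain of cardinality $\kappa$ satisfies $\varphi$. For theories $T_1,T_2$ over disjoint signatures, $T_1\oplus T_2$ is the theory over the union of the signatures whose axioms are those of $T_1$ together with those of $T_2$. Call $f:\{1,2,\dots\}\to\{0,1\}$ *admissible* if $f$ is not computable, $f(1)=1$, and, for every $k\ge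 1$, $f$ takes the values $0$ and $1$ equally often on $\{1,\dots,2^k\}$. Let $f_i(k)$ be the number of $j\in\{1,\dots,k\}$ with $f(j)=i$. Let $\Sigma_s$ be the signature with a single unary function symbol $s$ and no predicate symbol except equality, and let $T_f$ be the $\Sigma_s$-theory with, for each $k\ge1$, the axiom $$\bigl[\psi^{=}_{\ge f_1(k)}\wedge\psi^{\ne}_{\ge f_0(k)}\bigr]\vee\bigvee_{i=1}^{k}\bigl[\psi^{=}_{=f_1(i)}\wedge\psi^{\ne}_{=f_0(i)}\bigr],$$ where $\psi^{=}_{\ge n}$ and $\psi^{=}_{=n}$ (respectively $\psi^{\ne}_{\ge n}$ and $\psi^{\ne}_{=n}$) are the first-order sentences saying that at least $n$, respectively exactly $n$, elements $x$ satisfy $s(x)=x$ (respectively $s(x)\neq x$). Let $\Sigma_P$ be the signature with nullary predicate symbols $P_1,P_2,\dots$ and no function symbol, and let $T_=$ be the $\Sigma_P$-theory with the axioms $P_n\to\psi_{=n}$ for $n\ge1$, where $\psi_{=n}$ is the first-order sentence saying that the domain has exactly $n$ elements. **Theorem.** Admissible functions exist. For every admissible $f$, the theories $T_1=T_f$ and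 $T_2=T_=$, whose signatures are disjoint, are both decidable; $T_2$ has the finite model property and a computable minimal model function, but is not smooth; and $T_1\oplus T_2$ is undecidable. In particular, there are decidable theories $T_1,T_2$ over disjoint signatures such that $T_2$ has the finite model property and a computable minimal model function, but $T_1\oplus T_2$ is undecidable. -/

import Mathlib

namespace TheoryCombination

open FirstOrder FirstOrder.Language

/-! ### Interpretations, theories, satisfiability

Signatures are first-order languages; equality is a logical symbol of every language.  The
variables are indexed by `ℕ`, so a formula is an `L.Formula ℕ` and a quantifier-free formula is one
that satisfies `IsQF`.  A theory is given by its axiomatization, a set of sentences. -/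

/-- An `L`-interpretation: a domain, the meaning of the symbols of `L` on it, and a value in the
domain for each variable (so that the domain is nonempty). -/
structure Interpretation (L : FirstOrder.Language.{0, 0}) where
  /-- the domain -/
  dom : Type
  /-- the interpretation of the function and predicate symbols -/
  str : L.Structure dom
  /-- the values of the variables -/
  val : ℕ → dom

/-- `A` satisfies the formula `φ`. -/
def Interpretation.Satisfies {L : FirstOrder.Language.{0, 0}} (A : Interpretation L) (φ : L.Formula ℕ) :
    Prop :=
  letI := A.str
  φ.Realize A.val

/-- `A` is a `T`-interpretation: it satisfies all axioms of `T`. -/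
def Interpretation.IsModelOf {L : FirstOrder.Language.{0, 0}} (A : Interpretation L) (T : L.Theory) : Prop :=
  letI := A.str
  A.dom ⊨ T

/-- `φ` is `T`-satisfiable. -/
def Satisfiable {L : FirstOrder.Language.{0, 0}} (T : L.Theory) (φ : L.Formula ℕ) : Prop :=
  ∃ A : Interpretation L, A.IsModelOf T ∧ A.Satisfies φ

/-- The combination `T₁ ⊕ T₂`: the theory over the disjoint union of the two signatures that is
axiomatized by the union of the axioms of `T₁` and `T₂`. -/
def combine {L₁ L₂ : FirstOrder.Language.{0, 0}} (T₁ : L₁.Theory) (T₂ : L₂.Theory) : (L₁.sum L₂).Theory :=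
  (LHom.sumInl : L₁ →ᴸ L₁.sum L₂).onTheory T₁ ∪ (LHom.sumInr : L₂ →ᴸ L₁.sum L₂).onTheory T₂

/-! ### Gödel numbering of formulas -/

section Coding

variable {L : FirstOrder.Language.{0, 0}} [∀ n, Encodable (L.Functions n)] [∀ n, Encodable (L.Relations n)]

/-- The Gödel number of a term. -/
def termCode {α : Type} [Encodable α] : L.Term α → ℕ
  | .var a => 2 * Encodable.encode a
  | @Term.func _ _ n f ts =>
      2 * Nat.pair (Nat.pair n (Encodable.encode f))
        (Encodable.encode (List.ofFn fun i => termCode (ts i))) + 1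

/-- The Gödel number of a formula. -/
def formulaCode : ∀ {k : ℕ}, L.BoundedFormula ℕ k → ℕ
  | _, .falsum => 0
  | _, .equal t u => 4 * Nat.pair (termCode t) (termCode u) + 1
  | _, @BoundedFormula.rel _ _ _ n R ts =>
      4 * Nat.pair (Nat.pair n (Encodable.encode R))
        (Encodable.encode (List.ofFn fun i => termCode (ts i))) + 2
  | _, .imp φ ψ => 4 * Nat.pair (formulaCode φ) (formulaCode ψ) + 3
  | _, .all φ => 4 * formulaCode φ + 4

/-- `T` is decidable: the set of (Gödel numbers of) `T`-satisfiable quantifier-free formulas is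
computable. -/
def IsDecidable (T : L.Theory) : Prop :=
  ComputablePred fun c : ℕ => ∃ φ : L.Formula ℕ, φ.IsQF ∧ Satisfiable T φ ∧ formulaCode φ = c

end Coding

instance sumFunctionsEncodable {L₁ L₂ : FirstOrder.Language.{0, 0}} [∀ n, Encodable (L₁.Functions n)]
    [∀ n, Encodable (L₂.Functions n)] (n : ℕ) : Encodable ((L₁.sum L₂).Functions n) :=
  inferInstanceAs (Encodable (L₁.Functions n ⊕ L₂.Functions n))

instance sumRelationsEncodable {L₁ L₂ : FirstOrder.Language.{0, 0}} [∀ n, Encodable (L₁.Relations n)]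
    [∀ n, Encodable (L₂.Relations n)] (n : ℕ) : Encodable ((L₁.sum L₂).Relations n) :=
  inferInstanceAs (Encodable (L₁.Relations n ⊕ L₂.Relations n))

/-! ### The properties of theories involved in shiny combination -/

/-- `T` has the finite model property. -/
def HasFiniteModelProperty {L : FirstOrder.Language.{0, 0}} (T : L.Theory) : Prop :=
  ∀ φ : L.Formula ℕ, φ.IsQF → ∀ A : Interpretation L, A.IsModelOf T → A.Satisfies φ →
    ∃ B : Interpretation L, B.IsModelOf T ∧ B.Satisfies φ ∧ Cardinal.mk B.dom < Cardinal.aleph0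

/-- `T` is smooth. -/
def IsSmooth {L : FirstOrder.Language.{0, 0}} (T : L.Theory) : Prop :=
  ∀ φ : L.Formula ℕ, φ.IsQF → ∀ A : Interpretation L, A.IsModelOf T → A.Satisfies φ →
    ∀ κ : Cardinal.{0}, Cardinal.mk A.dom < κ →
      ∃ B : Interpretation L, B.IsModelOf T ∧ B.Satisfies φ ∧ Cardinal.mk B.dom = κ

/-- `m` is a minimal model function of `T`; its values are in `ℕ ∪ {ℵ₀}`, that is, in `ℕ∞`. -/
def IsMinimalModelFunction {L : FirstOrder.Language.{0, 0}} (T : L.Theory)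
    (m : {φ : L.Formula ℕ // φ.IsQF} → ℕ∞) : Prop :=
  ∀ φ : {φ : L.Formula ℕ // φ.IsQF}, Satisfiable T φ.1 →
    (∃ A : Interpretation L, A.IsModelOf T ∧ A.Satisfies φ.1 ∧
      Cardinal.mk A.dom = (m φ : Cardinal.{0})) ∧
    ∀ B : Interpretation L, B.IsModelOf T → B.Satisfies φ.1 →
      (m φ : Cardinal.{0}) ≤ Cardinal.mk B.dom

/-- Elements of `ℕ∞ = ℕ ∪ {∞}` are handled by algorithms as elements of `Option ℕ`. -/
instance enatPrimcodable : Primcodable ℕ∞ :=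
  inferInstanceAs (Primcodable (Option ℕ))

/-- `T` has a minimal model function that is computable (on Gödel numbers). -/
def HasComputableMinimalModelFunction {L : FirstOrder.Language.{0, 0}} [∀ n, Encodable (L.Functions n)]
    [∀ n, Encodable (L.Relations n)] (T : L.Theory) : Prop :=
  ∃ m : {φ : L.Formula ℕ // φ.IsQF} → ℕ∞, IsMinimalModelFunction T m ∧
    ∃ g : ℕ → ℕ∞, Computable g ∧ ∀ φ, g (formulaCode φ.1) = m φ

/-! ### Cardinality formulas -/

section CardinalityFormulas

variable {L : FirstOrder.Language.{0, 0}}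

/-- `x₁, …, xₙ` are pairwise distinct. -/
noncomputable def distinct (n : ℕ) : L.BoundedFormula Empty n :=
  BoundedFormula.iInf fun ij : {ij : Fin n × Fin n // ij.1 < ij.2} => ∼(&ij.1.1 =' &ij.1.2)

/-- `∃ x₁ … xₙ, ≠(x₁, …, xₙ) ∧ p(x₁) ∧ … ∧ p(xₙ)`, where `p` is a formula with a term as
argument: at least `n` elements satisfy `p`. -/
noncomputable def countGe (p : ∀ {k : ℕ}, L.Term (Empty ⊕ Fin k) → L.BoundedFormula Empty k)
    (n : ℕ) : L.Sentence :=
  (distinct n ⊓ BoundedFormula.iInf fun i : Fin n => p (&i)).exs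

/-- `∃ x₁ … xₙ, ≠(x₁, …, xₙ) ∧ p(x₁) ∧ … ∧ p(xₙ) ∧ ∀ x, p(x) → x = x₁ ∨ … ∨ x = xₙ`:
exactly `n` elements satisfy `p`. -/
noncomputable def countEq (p : ∀ {k : ℕ}, L.Term (Empty ⊕ Fin k) → L.BoundedFormula Empty k)
    (n : ℕ) : L.Sentence :=
  (distinct n ⊓ (BoundedFormula.iInf fun i : Fin n => p (&i)) ⊓
    ∀' (p (&(Fin.last n)) ⟹
      BoundedFormula.iSup fun i : Fin n => &(Fin.last n) =' &i.castSucc)).exs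

/-- `∃ x₁ … xₙ, ≠(x₁, …, xₙ)`: the domain has at least `n` elements. -/
noncomputable def cardAtLeast (n : ℕ) : L.Sentence :=
  (distinct n).exs

/-- `∃ x₁ … xₙ, ∀ y, y = x₁ ∨ … ∨ y = xₙ`: the domain has at most `n` elements. -/
noncomputable def cardAtMost (n : ℕ) : L.Sentence :=
  (∀' (BoundedFormula.iSup fun i : Fin n => &(Fin.last n) =' &i.castSucc)).exs

/-- The domain has exactly `n` elements. -/
noncomputable def cardExactly (n : ℕ) : L.Sentence :=
  cardAtLeast n ⊓ cardAtMost n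

end CardinalityFormulas

/-! ### The theory `T_f` -/

/-- The function symbols of `Σ_s`: a single unary symbol `s`. -/
def SFunctions : ℕ → Type
  | 1 => Unit
  | _ => Empty

/-- The signature `Σ_s`, with a unary function symbol `s` and no predicate symbol but equality. -/
def sigmaS : FirstOrder.Language.{0, 0} := ⟨SFunctions, fun _ => Empty⟩

instance sFunctionsEncodable : ∀ n, Encodable (sigmaS.Functions n)
  | 0 => inferInstanceAs (Encodable Empty)
  | 1 => inferInstanceAs (Encodable Unit)
  | _ + 2 => inferInstanceAs (Encodable Empty)

instance sRelationsEncodable (n : ℕ) : Encodable (sigmaS.Relations n) :=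
  inferInstanceAs (Encodable Empty)

/-- The symbol `s`. -/
def sSymbol : sigmaS.Functions 1 := ()

/-- `s(t) = t`. -/
def fixedBy {k : ℕ} (t : sigmaS.Term (Empty ⊕ Fin k)) : sigmaS.BoundedFormula Empty k :=
  Term.func sSymbol ![t] =' t

/-- `¬ s(t) = t`. -/
def movedBy {k : ℕ} (t : sigmaS.Term (Empty ⊕ Fin k)) : sigmaS.BoundedFormula Empty k :=
  ∼(fixedBy t)

/-- The number of `i ∈ {1, …, k}` that `f` maps to `b`: `f₁(k)` for `b = true`, `f₀(k)` for
`b = false`. -/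
def countValues (f : ℕ+ → Bool) (b : Bool) (k : ℕ+) : ℕ :=
  ((Finset.Icc 1 k).filter fun i => f i = b).card

/-- The functions `f` from the positive integers to `{0, 1}` used to define `T_f`: `f` is not
computable, `f(1) = 1`, and, for `k ≥ 1`, `f` maps half of the numbers in `{1, …, 2 ^ k}` to `1`
and the other half to `0`. -/
def IsAdmissible (f : ℕ+ → Bool) : Prop :=
  ¬ Computable f ∧ f 1 = true ∧
    ∀ k : ℕ, 1 ≤ k → countValues f true (2 ^ k) = countValues f false (2 ^ k)

/-- The axiom of `T_f` with index `k`. -/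
noncomputable def axiomTf (f : ℕ+ → Bool) (k : ℕ+) : sigmaS.Sentence :=
  (countGe fixedBy (countValues f true k) ⊓ countGe movedBy (countValues f false k)) ⊔
    BoundedFormula.iSup fun i : {i : ℕ+ // i ≤ k} =>
      countEq fixedBy (countValues f true i) ⊓ countEq movedBy (countValues f false i)

/-- The theory `T_f`. -/
noncomputable def Tf (f : ℕ+ → Bool) : sigmaS.Theory :=
  Set.range (axiomTf f)

/-! ### The theory `T_=` -/

/-- The predicate symbols of `Σ_P`: symbols `P₁, P₂, …` of arity `0`. -/
def PRelations : ℕ → Type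
  | 0 => ℕ+
  | _ => Empty

/-- The signature `Σ_P`, with `0`-ary predicate symbols `P₁, P₂, …` and no function symbol. -/
def sigmaP : FirstOrder.Language.{0, 0} := ⟨fun _ => Empty, PRelations⟩

instance pFunctionsEncodable (n : ℕ) : Encodable (sigmaP.Functions n) :=
  inferInstanceAs (Encodable Empty)

instance pRelationsEncodable : ∀ n, Encodable (sigmaP.Relations n)
  | 0 => inferInstanceAs (Encodable ℕ+)
  | _ + 1 => inferInstanceAs (Encodable Empty)

/-- The symbol `Pₙ`. -/
def pSymbol (n : ℕ+) : sigmaP.Relations 0 := n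

/-- The theory `T_=`, with the axioms `Pₙ → (the domain has exactly n elements)`, `n ≥ 1`. -/
noncomputable def Teq : sigmaP.Theory :=
  Set.range fun n : ℕ+ => (BoundedFormula.rel (pSymbol n) ![] ⟹ cardExactly n : sigmaP.Sentence)

end TheoryCombination

/-!
The truth of a quantifier-free formula depends only on the values of the terms occurring in it.

Hence adding infinitely many fixed points of `s` and infinitely many moved points to a
`Σ_s`-interpretation does not affect quantifier-free formulas, while it yields an interpretation in
`T_f`. So, whatever `f` is, satisfiability in `T_f` of a quantifier-free formula is just
satisfiability, which is decided by searching for an interpretation on the values of its terms.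

Let `A` be an interpretation in `T_=` satisfying `φ`. If some `Pₙ` with `n` at most the Gödel number
of `φ` holds in `A`, then `A` has `n` elements; otherwise all the `Pₙ` may be made false and the
domain cut down to the values of the terms of `φ`. Either way `φ` has a model in `T_=` that is no
larger than `A` and whose size is bounded by the Gödel number of `φ`. Satisfiability, and the least
size of a model, are thus found by a bounded search.

A `Σ_s`-interpretation with `n` elements is in `T_f` if and only if `s` has exactly `f₁(n)` fixed
points. So the formula saying that `Pₙ` holds and `x₀, …, xₖ` are distinct fixed points of `s` is
satisfiable in `T_f ⊕ T_=` if and only if `k < f₁(n)`: a decision procedure for the combination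
would compute `f₁`, and with it `f`.
-/

namespace TheoryCombination

open FirstOrder FirstOrder.Language

/-! ### Course-of-values recursion -/

section CourseOfValues

variable {α σ : Type*}

/-- The list of the first `n` values of `courseOfValues g`. -/
def courseOfValuesList (g : List σ → σ) : ℕ → List σ
  | 0 => []
  | n + 1 => courseOfValuesList g n ++ [g (courseOfValuesList g n)]

/-- The function on `ℕ` defined by course-of-values recursion: `g` computes a value from the list of
all previous ones. -/
def courseOfValues (g : List σ → σ) (n : ℕ) : σ :=
  g (courseOfValuesList g n)

theorem courseOfValuesList_eq_map_range (g : List σ → σ) (n : ℕ) :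
    courseOfValuesList g n = (List.range n).map (courseOfValues g) := by
  induction n with
  | zero => rfl
  | succ n ih =>
    rw [List.range_succ, List.map_append, ← ih]
    rfl

theorem courseOfValues_eq (g : List σ → σ) (n : ℕ) :
    courseOfValues g n = g ((List.range n).map (courseOfValues g)) :=
  congrArg g (courseOfValuesList_eq_map_range g n)

theorem getD_map_range (f : ℕ → σ) (d : σ) {k n : ℕ} (h : k < n) :
    ((List.range n).map f).getD k d = f k := by
  simp [List.getD, h]

theorem primrec_courseOfValues [Primcodable α] [Primcodable σ] {g : α → List σ → σ}
    (hg : Primrec₂ g) : Primrec₂ fun a n => courseOfValues (g a) n :=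
  Primrec.nat_strong_rec _ (g := fun a l => some (g a l)) (Primrec.option_some.comp hg)
    fun a n => congrArg some (courseOfValues_eq (g a) n).symm

end CourseOfValues

/-! ### Recursion on codes of formulas -/

section FormulaFold

variable {α σ : Type*}

/-- The step of the course-of-values recursion `formulaFold`. -/
def formulaFoldStep (bot : σ) (eq : ℕ → ℕ → σ) (rel : ℕ → σ) (imp : σ → σ → σ) (all : σ → σ)
    (l : List σ) : σ :=
  let q := (l.length - 1) / 4
  if l.length = 0 then bot
  else if l.length % 4 = 1 then eq q.unpair.1 q.unpair.2
  else if l.length % 4 = 2 then rel q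
  else if l.length % 4 = 3 then imp (l.getD q.unpair.1 bot) (l.getD q.unpair.2 bot)
  else all (l.getD q bot)

/-- Structural recursion on formulas, carried out on their Gödel numbers. -/
def formulaFold (bot : σ) (eq : ℕ → ℕ → σ) (rel : ℕ → σ) (imp : σ → σ → σ) (all : σ → σ) (c : ℕ) :
    σ :=
  courseOfValues (formulaFoldStep bot eq rel imp all) c

theorem primrec_formulaFold [Primcodable α] [Primcodable σ] (bot : σ) {eq : α → ℕ → ℕ → σ}
    {rel : α → ℕ → σ} {imp : σ → σ → σ} {all : σ → σ}
    (heq : Primrec fun p : α × ℕ × ℕ => eq p.1 p.2.1 p.2.2) (hrel : Primrec₂ rel)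
    (himp : Primrec₂ imp) (hall : Primrec all) :
    Primrec₂ fun a c => formulaFold bot (eq a) (rel a) imp all c := by
  refine primrec_courseOfValues ?_
  have hlen : Primrec fun p : α × List σ => p.2.length := Primrec.list_length.comp Primrec.snd
  have hmod : Primrec fun p : α × List σ => p.2.length % 4 :=
    Primrec.nat_mod.comp hlen (Primrec.const 4)
  have hq : Primrec fun p : α × List σ => (p.2.length - 1) / 4 :=
    Primrec.nat_div.comp (Primrec.pred.comp hlen) (Primrec.const 4)
  have hq₁ := Primrec.fst.comp (Primrec.unpair.comp hq)
  have hq₂ := Primrec.snd.comp (Primrec.unpair.comp hq)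
  have hget {i : α × List σ → ℕ} (hi : Primrec i) :
      Primrec fun p : α × List σ => p.2.getD (i p) bot :=
    (Primrec.list_getD bot).comp Primrec.snd hi
  exact Primrec.ite (Primrec.eq.comp hlen (Primrec.const 0)) (Primrec.const bot) <|
    Primrec.ite (Primrec.eq.comp hmod (Primrec.const 1))
      (heq.comp (Primrec.fst.pair (hq₁.pair hq₂))) <|
    Primrec.ite (Primrec.eq.comp hmod (Primrec.const 2)) (hrel.comp Primrec.fst hq) <|
    Primrec.ite (Primrec.eq.comp hmod (Primrec.const 3)) (himp.comp (hget hq₁) (hget hq₂))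
      (hall.comp (hget hq))

variable (bot : σ) (eq : ℕ → ℕ → σ) (rel : ℕ → σ) (imp : σ → σ → σ) (all : σ → σ)

theorem formulaFold_equal (t u : ℕ) :
    formulaFold bot eq rel imp all (4 * Nat.pair t u + 1) = eq t u := by
  have hmod : (4 * Nat.pair t u + 1) % 4 = 1 := by omega
  rw [formulaFold, courseOfValues_eq]
  simp [formulaFoldStep, hmod]

theorem formulaFold_rel (x : ℕ) : formulaFold bot eq rel imp all (4 * x + 2) = rel x := by
  have hmod : (4 * x + 2) % 4 = 2 := by omega
  have hdiv : (4 * x + 1) / 4 = x := by omega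
  rw [formulaFold, courseOfValues_eq]
  simp [formulaFoldStep, hmod, hdiv]

theorem formulaFold_imp (x y : ℕ) :
    formulaFold bot eq rel imp all (4 * Nat.pair x y + 3) =
      imp (formulaFold bot eq rel imp all x) (formulaFold bot eq rel imp all y) := by
  have hmod : (4 * Nat.pair x y + 3) % 4 = 3 := by omega
  have hdiv : (4 * Nat.pair x y + 2) / 4 = Nat.pair x y := by omega
  have hx : x < 4 * Nat.pair x y + 3 := by have := Nat.left_le_pair x y; omega
  have hy : y < 4 * Nat.pair x y + 3 := by have := Nat.right_le_pair x y; omega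
  rw [formulaFold, courseOfValues_eq]
  simp only [formulaFoldStep, List.length_map, List.length_range, hmod, Nat.add_one_sub_one, hdiv,
    Nat.unpair_pair, getD_map_range _ _ hx, getD_map_range _ _ hy]
  simp [formulaFold]

theorem formulaFold_all (x : ℕ) :
    formulaFold bot eq rel imp all (4 * x + 4) = all (formulaFold bot eq rel imp all x) := by
  have hmod : (4 * x + 4) % 4 = 0 := by omega
  have hdiv : (4 * x + 3) / 4 = x := by omega
  have hx : x < 4 * x + 4 := by omega
  rw [formulaFold, courseOfValues_eq]
  simp only [formulaFoldStep, List.length_map, List.length_range, hmod, Nat.add_one_sub_one, hdiv,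
    getD_map_range _ _ hx]
  simp [formulaFold]

end FormulaFold

/-! ### Quantifier-free formulas and their codes -/

section QuantifierFree

variable {L : FirstOrder.Language.{0, 0}}

theorem isQF_induction {P : ∀ φ : L.Formula ℕ, φ.IsQF → Prop}
    (falsum : P BoundedFormula.falsum .falsum)
    (equal : ∀ t u, P (BoundedFormula.equal t u) (.of_isAtomic (.equal t u)))
    (rel : ∀ {n} (R : L.Relations n) ts, P (BoundedFormula.rel R ts) (.of_isAtomic (.rel R ts)))
    (imp : ∀ φ ψ hφ hψ, P φ hφ → P ψ hψ → P (BoundedFormula.imp φ ψ) (.imp hφ hψ))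
    (φ : L.Formula ℕ) (hφ : φ.IsQF) : P φ hφ := by
  induction hφ with
  | falsum => exact falsum
  | of_isAtomic h =>
    cases h with
    | equal t u => exact equal t u
    | rel R ts => exact rel R ts
  | imp _ _ ihφ ihψ => exact imp _ _ _ _ ihφ ihψ

/-- The element denoted by a term in an interpretation. -/
def Interpretation.eval (A : Interpretation L) (t : L.Term (ℕ ⊕ Fin 0)) : A.dom :=
  letI := A.str
  t.realize (Sum.elim A.val default)

/-- The truth of an atomic formula other than an equation in an interpretation. -/
def Interpretation.HoldsAtom (A : Interpretation L) {n : ℕ} (R : L.Relations n)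
    (ts : Fin n → L.Term (ℕ ⊕ Fin 0)) : Prop :=
  letI := A.str
  Structure.RelMap R fun i => A.eval (ts i)

variable [∀ n, Encodable (L.Functions n)]

theorem termCode_var (x : ℕ) : termCode (L := L) (.var (Sum.inl x : ℕ ⊕ Fin 0)) = 4 * x := by
  rw [termCode, Encodable.encode_inl, Encodable.encode_nat]
  omega

variable [∀ n, Encodable (L.Relations n)]

/-- The Gödel number of `R(ts)` without the tag: `formulaCode` is `4 * atomCode R ts + 2`. -/
def atomCode {n : ℕ} (R : L.Relations n) (ts : Fin n → L.Term (ℕ ⊕ Fin 0)) : ℕ :=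
  Nat.pair (Nat.pair n (Encodable.encode R)) (Encodable.encode (List.ofFn fun i => termCode (ts i)))

theorem satisfies_iff_of_agree {A B : Interpretation L} {φ : L.Formula ℕ} (hφ : φ.IsQF)
    (heq : ∀ t u, termCode t < formulaCode φ → termCode u < formulaCode φ →
      (A.eval t = A.eval u ↔ B.eval t = B.eval u))
    (hrel : ∀ {n} (R : L.Relations n) ts, atomCode R ts < formulaCode φ →
      (A.HoldsAtom R ts ↔ B.HoldsAtom R ts)) :
    A.Satisfies φ ↔ B.Satisfies φ := by
  induction φ, hφ using isQF_induction with
  | falsum => exact Iff.rfl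
  | equal t u =>
    have ht := Nat.left_le_pair (termCode t) (termCode u)
    have hu := Nat.right_le_pair (termCode t) (termCode u)
    exact heq t u (by rw [formulaCode]; omega) (by rw [formulaCode]; omega)
  | rel R ts => exact hrel R ts (show atomCode R ts < 4 * atomCode R ts + 2 by omega)
  | imp φ ψ _ _ ihφ ihψ =>
    have hφ : formulaCode φ < formulaCode (φ.imp ψ) := by
      have := Nat.left_le_pair (formulaCode φ) (formulaCode ψ)
      rw [formulaCode]; omega
    have hψ : formulaCode ψ < formulaCode (φ.imp ψ) := by
      have := Nat.right_le_pair (formulaCode φ) (formulaCode ψ)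
      rw [formulaCode]; omega
    exact imp_congr
      (ihφ (fun t u ht hu => heq t u (ht.trans hφ) (hu.trans hφ))
        fun R ts h => hrel R ts (h.trans hφ))
      (ihψ (fun t u ht hu => heq t u (ht.trans hψ) (hu.trans hψ))
        fun R ts h => hrel R ts (h.trans hψ))

/-- The truth value of a quantifier-free formula as a function of its Gödel number, given the truth
values of the equations between terms and of the other atomic formulas. -/
def evalCode (eq : ℕ → ℕ → Bool) (rel : ℕ → Bool) (c : ℕ) : Bool :=
  formulaFold false eq rel (fun x y => !x || y) (fun _ => false) c

theorem primrec_evalCode {α : Type*} [Primcodable α] {eq : α → ℕ → ℕ → Bool} {rel : α → ℕ → Bool}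
    (heq : Primrec fun p : α × ℕ × ℕ => eq p.1 p.2.1 p.2.2) (hrel : Primrec₂ rel) :
    Primrec₂ fun a c => evalCode (eq a) (rel a) c :=
  primrec_formulaFold false heq hrel (Primrec.dom_bool₂ _) (Primrec.const false)

theorem evalCode_formulaCode {A : Interpretation L} {eq : ℕ → ℕ → Bool} {rel : ℕ → Bool}
    (heq : ∀ t u : L.Term (ℕ ⊕ Fin 0),
      eq (termCode t) (termCode u) = true ↔ A.eval t = A.eval u)
    (hrel : ∀ {n} (R : L.Relations n) ts, rel (atomCode R ts) = true ↔ A.HoldsAtom R ts)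
    {φ : L.Formula ℕ} (hφ : φ.IsQF) :
    evalCode eq rel (formulaCode φ) = true ↔ A.Satisfies φ := by
  induction φ, hφ using isQF_induction with
  | falsum => exact iff_of_false Bool.false_ne_true id
  | equal t u => exact (Eq.congr_left (formulaFold_equal ..)).trans (heq t u)
  | rel R ts => exact (Eq.congr_left (formulaFold_rel ..)).trans (hrel R ts)
  | imp φ ψ _ _ ihφ ihψ =>
    change _ ↔ (A.Satisfies φ → A.Satisfies ψ)
    rw [← ihφ, ← ihψ, formulaCode, evalCode, formulaFold_imp, ← evalCode, ← evalCode]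
    cases evalCode eq rel (formulaCode φ) <;> simp

theorem formulaCode_induction {P : ℕ → Prop} (falsum : P 0)
    (equal : ∀ t u, P (4 * Nat.pair t u + 1))
    (rel : ∀ x, P (4 * x + 2)) (imp : ∀ x y, P x → P y → P (4 * Nat.pair x y + 3))
    (all : ∀ x, P x → P (4 * x + 4)) (c : ℕ) : P c := by
  induction c using Nat.strong_induction_on with
  | _ c ih =>
  obtain rfl | ⟨q, rfl | rfl | rfl | rfl⟩ : c = 0 ∨ ∃ q, c = 4 * q + 1 ∨ c = 4 * q + 2 ∨
      c = 4 * q + 3 ∨ c = 4 * q + 4 := by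
    rcases c.eq_zero_or_pos with hc | hc
    exacts [.inl hc, .inr ⟨(c - 1) / 4, by omega⟩]
  · exact falsum
  · simpa only [Nat.pair_unpair] using equal q.unpair.1 q.unpair.2
  · exact rel q
  · have h₁ := Nat.unpair_left_le q
    have h₂ := Nat.unpair_right_le q
    simpa only [Nat.pair_unpair] using imp _ _ (ih q.unpair.1 (by omega)) (ih q.unpair.2 (by omega))
  · exact all q (ih q (by omega))

variable (L)

/-- The Gödel numbers of terms with variables in `ℕ`. -/
def IsTermCode (x : ℕ) : Prop :=
  ∃ t : L.Term (ℕ ⊕ Fin 0), termCode t = x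

/-- The numbers that `atomCode` assigns to atomic formulas. -/
def IsAtomCode (x : ℕ) : Prop :=
  ∃ (n : ℕ) (R : L.Relations n) (ts : Fin n → L.Term (ℕ ⊕ Fin 0)), atomCode R ts = x

/-- The Gödel numbers of quantifier-free formulas. -/
def IsQFCode (c : ℕ) : Prop :=
  ∃ φ : L.Formula ℕ, φ.IsQF ∧ formulaCode φ = c

theorem formulaFold_eq_true_iff_isQFCode [DecidablePred (IsTermCode L)]
    [DecidablePred (IsAtomCode L)] (c : ℕ) :
    formulaFold true (fun t u => decide (IsTermCode L t) && decide (IsTermCode L u))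
      (fun x => decide (IsAtomCode L x)) (· && ·) (fun _ => false) c = true ↔ IsQFCode L c := by
  constructor
  · induction c using formulaCode_induction with
    | falsum => exact fun _ => ⟨⊥, .falsum, rfl⟩
    | equal t u =>
      rw [formulaFold_equal, Bool.and_eq_true, decide_eq_true_iff, decide_eq_true_iff]
      rintro ⟨⟨t, rfl⟩, u, rfl⟩
      exact ⟨.equal t u, .of_isAtomic (.equal t u), rfl⟩
    | rel x =>
      rw [formulaFold_rel, decide_eq_true_iff]
      rintro ⟨n, R, ts, rfl⟩
      exact ⟨.rel R ts, .of_isAtomic (.rel R ts), rfl⟩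
    | imp x y ihx ihy =>
      rw [formulaFold_imp, Bool.and_eq_true]
      rintro ⟨hx, hy⟩
      obtain ⟨φ, hφ, rfl⟩ := ihx hx
      obtain ⟨ψ, hψ, rfl⟩ := ihy hy
      exact ⟨BoundedFormula.imp φ ψ, hφ.imp hψ, rfl⟩
    | all x => simp [formulaFold_all]
  · rintro ⟨φ, hφ, rfl⟩
    induction φ, hφ using isQF_induction with
    | falsum => rfl
    | equal t u => simp [formulaCode, formulaFold_equal, IsTermCode]
    | rel R ts =>
      exact (formulaFold_rel ..).trans (decide_eq_true (⟨_, R, ts, rfl⟩ : IsAtomCode L _))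
    | imp φ ψ _ _ ihφ ihψ => rw [formulaCode, formulaFold_imp, ihφ, ihψ, Bool.and_self]

variable {L}

theorem primrecPred_isQFCode (hterm : PrimrecPred (IsTermCode L))
    (hatom : PrimrecPred (IsAtomCode L)) : PrimrecPred (IsQFCode L) := by
  obtain ⟨_, hterm⟩ := hterm
  obtain ⟨_, hatom⟩ := hatom
  have hfold := primrec_formulaFold (α := Unit) true
    (eq := fun _ t u => decide (IsTermCode L t) && decide (IsTermCode L u))
    (Primrec.and.comp (hterm.comp (Primrec.fst.comp Primrec.snd))
      (hterm.comp (Primrec.snd.comp Primrec.snd))) (hatom.comp Primrec.snd).to₂ Primrec.and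
    (Primrec.const false)
  exact (Primrec.eq.comp (hfold.comp (Primrec.const ()) Primrec.id) (Primrec.const true)).of_eq
    (formulaFold_eq_true_iff_isQFCode L)

theorem isDecidable_of_primrecPred {T : L.Theory} (hqf : PrimrecPred (IsQFCode L)) {p : ℕ → Prop}
    (hp : PrimrecPred p) (h : ∀ φ : L.Formula ℕ, φ.IsQF → (Satisfiable T φ ↔ p (formulaCode φ))) :
    IsDecidable T := by
  refine (hqf.and hp).computablePred.of_eq fun c => ⟨?_, ?_⟩
  · rintro ⟨⟨φ, hφ, rfl⟩, hc⟩
    exact ⟨φ, hφ, (h φ hφ).2 hc, rfl⟩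
  · rintro ⟨φ, hφ, hsat, rfl⟩
    exact ⟨⟨φ, hφ, rfl⟩, (h φ hφ).1 hsat⟩

theorem IsDecidable.congr {T T' : L.Theory} (hT : IsDecidable T)
    (h : ∀ φ : L.Formula ℕ, φ.IsQF → (Satisfiable T φ ↔ Satisfiable T' φ)) : IsDecidable T' :=
  hT.of_eq fun _ => exists_congr fun φ => and_congr_right fun hφ => and_congr_left' (h φ hφ)

end QuantifierFree

/-! ### Injectivity of the Gödel numbering -/

section Injectivity

variable {L : FirstOrder.Language.{0, 0}} [∀ n, Encodable (L.Functions n)]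

theorem termCode_injective {α : Type} [Encodable α] :
    Function.Injective (termCode : L.Term α → ℕ) := by
  intro t
  induction t with
  | var a =>
    rintro (b | ⟨g, us⟩) h <;> simp only [termCode] at h
    · rw [Encodable.encode_injective (Nat.eq_of_mul_eq_mul_left two_pos h)]
    · omega
  | func f ts ih =>
    rintro (b | ⟨g, us⟩) h <;> simp only [termCode] at h
    · omega
    obtain ⟨hsymb, hargs⟩ :=
      Nat.pair_eq_pair.1 (Nat.eq_of_mul_eq_mul_left two_pos (Nat.add_right_cancel h))
    obtain ⟨rfl, hsymb⟩ := Nat.pair_eq_pair.1 hsymb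
    obtain rfl := Encodable.encode_injective hsymb
    have hargs := List.ofFn_injective (Encodable.encode_injective hargs)
    exact congrArg _ (funext fun i => ih i (congrFun hargs i))

theorem formulaCode_injective [∀ n, Encodable (L.Relations n)] {k : ℕ} :
    Function.Injective (formulaCode : L.BoundedFormula ℕ k → ℕ) := by
  intro φ
  induction φ with
  | falsum => rintro (_ | _ | _ | _ | _) h <;> simp only [formulaCode] at h <;> first | rfl | omega
  | equal t u =>
    rintro (_ | _ | _ | _ | _) h <;> simp only [formulaCode] at h <;> try omega
    have h := Nat.pair_eq_pair.1 (Nat.eq_of_mul_eq_mul_left four_pos (Nat.add_right_cancel h))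
    rw [termCode_injective h.1, termCode_injective h.2]
  | rel R ts =>
    rintro (_ | _ | ⟨R', us⟩ | _ | _) h <;> simp only [formulaCode] at h <;> try omega
    obtain ⟨hsymb, hargs⟩ :=
      Nat.pair_eq_pair.1 (Nat.eq_of_mul_eq_mul_left four_pos (Nat.add_right_cancel h))
    obtain ⟨rfl, hsymb⟩ := Nat.pair_eq_pair.1 hsymb
    obtain rfl := Encodable.encode_injective hsymb
    have hargs := List.ofFn_injective (Encodable.encode_injective hargs)
    exact congrArg _ (funext fun i => termCode_injective (congrFun hargs i))
  | imp φ ψ ihφ ihψ =>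
    rintro (_ | _ | _ | _ | _) h <;> simp only [formulaCode] at h <;> try omega
    have h := Nat.pair_eq_pair.1 (Nat.eq_of_mul_eq_mul_left four_pos (Nat.add_right_cancel h))
    rw [ihφ h.1, ihψ h.2]
  | all φ ih =>
    rintro (_ | _ | _ | _ | _) h <;> simp only [formulaCode] at h <;> try omega
    rw [ih (Nat.eq_of_mul_eq_mul_left four_pos (Nat.add_right_cancel h))]

end Injectivity

/-! ### Small models -/

section SmallModels

variable {L : FirstOrder.Language.{0, 0}}

open Classical in
/-- The interpretation on `V` that agrees with `A` wherever `A` stays inside `V`; values of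
functions and variables outside `V` are replaced by `v₀`. -/
noncomputable abbrev Interpretation.restrict (A : Interpretation L) (V : Set A.dom) (v₀ : V) :
    Interpretation L where
  dom := V
  str := letI := A.str
    { funMap := fun f xs =>
        if h : Structure.funMap f (fun i => (xs i : A.dom)) ∈ V then ⟨_, h⟩ else v₀
      RelMap := fun R xs => Structure.RelMap R fun i => (xs i : A.dom) }
  val x := if h : A.val x ∈ V then ⟨_, h⟩ else v₀

variable [∀ n, Encodable (L.Functions n)] {A : Interpretation L} {V : Set A.dom}

theorem lt_encode_of_mem {α : Type*} [Encodable α] {a : α} {l : List α} (h : a ∈ l) :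
    Encodable.encode a < Encodable.encode l := by
  induction l with
  | nil => cases h
  | cons b l ih =>
    rw [Encodable.encode_list_cons, Nat.lt_succ_iff]
    rcases List.mem_cons.1 h with rfl | h
    · exact Nat.left_le_pair _ _
    · exact (ih h).le.trans (Nat.right_le_pair _ _)

theorem termCode_lt_encode_ofFn {n : ℕ} (ts : Fin n → L.Term (ℕ ⊕ Fin 0)) (i : Fin n) :
    termCode (ts i) < Encodable.encode (List.ofFn fun i => termCode (ts i)) :=
  lt_encode_of_mem (a := termCode (ts i)) (List.mem_ofFn.2 ⟨i, rfl⟩)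

theorem termCode_arg_lt {n : ℕ} (f : L.Functions n) (ts : Fin n → L.Term (ℕ ⊕ Fin 0)) (i : Fin n) :
    termCode (ts i) < termCode (Term.func f ts) := by
  have := termCode_lt_encode_ofFn ts i
  have := Nat.right_le_pair (Nat.pair n (Encodable.encode f))
    (Encodable.encode (List.ofFn fun i => termCode (ts i)))
  rw [termCode]
  omega

theorem coe_eval_restrict {c : ℕ} (v₀ : V) (hV : ∀ t, termCode t ≤ c → A.eval t ∈ V)
    (t : L.Term (ℕ ⊕ Fin 0)) (ht : termCode t ≤ c) :
    ((A.restrict V v₀).eval t : A.dom) = A.eval t := by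
  induction t with
  | var x =>
    rcases x with x | x
    · exact congrArg Subtype.val (dif_pos (hV _ ht))
    · exact x.elim0
  | func f ts ih =>
    have hargs : (fun i => ((A.restrict V v₀).eval (ts i) : A.dom)) = fun i => A.eval (ts i) :=
      funext fun i => ih i ((termCode_arg_lt f ts i).le.trans ht)
    let := A.str
    have hmem : Structure.funMap f (fun i => ((A.restrict V v₀).eval (ts i) : A.dom)) ∈ V :=
      hargs ▸ hV _ ht
    exact (congrArg Subtype.val (dif_pos hmem)).trans (congrArg (Structure.funMap f) hargs)

variable [∀ n, Encodable (L.Relations n)]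

theorem termCode_arg_lt_atomCode {n : ℕ} (R : L.Relations n) (ts : Fin n → L.Term (ℕ ⊕ Fin 0))
    (i : Fin n) : termCode (ts i) < atomCode R ts :=
  (termCode_lt_encode_ofFn ts i).trans_le (Nat.right_le_pair _ _)

theorem satisfies_restrict_iff {φ : L.Formula ℕ} (hφ : φ.IsQF) (v₀ : V)
    (hV : ∀ t, termCode t ≤ formulaCode φ → A.eval t ∈ V) :
    (A.restrict V v₀).Satisfies φ ↔ A.Satisfies φ := by
  have heval := coe_eval_restrict v₀ hV
  refine satisfies_iff_of_agree hφ (fun t u ht hu => ?_) fun R ts h => ?_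
  · rw [← heval t ht.le, ← heval u hu.le, Subtype.ext_iff]
  · let := A.str
    have hargs : (fun i => ((A.restrict V v₀).eval (ts i) : A.dom)) = fun i => A.eval (ts i) :=
      funext fun i => heval _ ((termCode_arg_lt_atomCode R ts i).le.trans h.le)
    exact iff_of_eq (congrArg (Structure.RelMap R) hargs)

theorem exists_restrict_satisfies {φ : L.Formula ℕ} (hφ : φ.IsQF) (h : A.Satisfies φ) :
    ∃ (V : Set A.dom) (v₀ : V), ∃ N ≤ formulaCode φ,
      Cardinal.mk V = (N + 1 : ℕ) ∧ (A.restrict V v₀).Satisfies φ := by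
  let S : Set (L.Term (ℕ ⊕ Fin 0)) := {t | termCode t ≤ formulaCode φ}
  have hSfin : S.Finite := (Set.finite_Iic _).preimage termCode_injective.injOn
  have hScard : S.ncard ≤ formulaCode φ + 1 := by
    rw [← Nat.card_Iic, ← Set.ncard_coe_finset, Finset.coe_Iic]
    exact Set.ncard_le_ncard_of_injOn _ (fun t ht => ht) termCode_injective.injOn
  let v₀ : A.eval '' S := ⟨_, .var (Sum.inl 0), by simp [S, termCode_var], rfl⟩
  have hpos : 0 < (A.eval '' S).ncard := (Set.ncard_pos (hSfin.image _)).2 ⟨_, v₀.2⟩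
  refine ⟨A.eval '' S, v₀, (A.eval '' S).ncard - 1, ?_, ?_,
    (satisfies_restrict_iff hφ v₀ fun t ht => ⟨t, ht, rfl⟩).2 h⟩
  · have := (Set.ncard_image_le (f := A.eval) hSfin).trans hScard
    omega
  · have := (hSfin.image A.eval).to_subtype
    rw [Nat.sub_add_cancel hpos, ← Nat.card_coe_set_eq, Nat.cast_card]

end SmallModels

/-! ### Theories with small models -/

section HasSmallModels

variable {L : FirstOrder.Language.{0, 0}} {T : L.Theory} {φ : L.Formula ℕ}

/-- `φ` is satisfied by an interpretation in `T` with `N` elements. -/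
def HasModelOfCard (T : L.Theory) (φ : L.Formula ℕ) (N : ℕ) : Prop :=
  ∃ A : Interpretation L, A.IsModelOf T ∧ A.Satisfies φ ∧ Cardinal.mk A.dom = N

theorem HasModelOfCard.satisfiable {N : ℕ} (h : HasModelOfCard T φ N) : Satisfiable T φ :=
  let ⟨A, hA, hφ, _⟩ := h
  ⟨A, hA, hφ⟩

theorem hasModelOfCard_iff_exists_fin {N : ℕ} :
    HasModelOfCard T φ N ↔ ∃ (S : L.Structure (Fin N)) (v : ℕ → Fin N),
      (⟨Fin N, S, v⟩ : Interpretation L).IsModelOf T ∧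
        (⟨Fin N, S, v⟩ : Interpretation L).Satisfies φ := by
  constructor
  · rintro ⟨A, hA, hφ, hN⟩
    obtain ⟨e⟩ := Cardinal.eq.1 (hN.trans (Cardinal.mk_fin N).symm)
    let := A.str
    let := e.inducedStructure (L := L)
    have : A.dom ⊨ T := hA
    exact ⟨e.inducedStructure, e ∘ A.val,
      StrongHomClass.theory_model (e.inducedStructureEquiv (L := L)),
      (StrongHomClass.realize_formula (e.inducedStructureEquiv (L := L)) φ).2 hφ⟩
  · rintro ⟨S, v, hT, hφ⟩
    exact ⟨_, hT, hφ, Cardinal.mk_fin N⟩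

variable [∀ n, Encodable (L.Functions n)] [∀ n, Encodable (L.Relations n)]

/-- A quantifier-free formula satisfied by a `T`-interpretation is satisfied by one that is no
larger and whose size is bounded by the Gödel number of the formula. -/
def HasSmallModels (T : L.Theory) : Prop :=
  ∀ φ : L.Formula ℕ, φ.IsQF → ∀ A : Interpretation L, A.IsModelOf T → A.Satisfies φ →
    ∃ N ≤ formulaCode φ, ((N + 1 : ℕ) : Cardinal) ≤ Cardinal.mk A.dom ∧ HasModelOfCard T φ (N + 1)

theorem HasSmallModels.hasFiniteModelProperty (hT : HasSmallModels T) :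
    HasFiniteModelProperty T := by
  intro φ hφ A hA h
  obtain ⟨N, -, -, B, hB, hBφ, hN⟩ := hT φ hφ A hA h
  exact ⟨B, hB, hBφ, hN ▸ Cardinal.natCast_lt_aleph0⟩

theorem HasSmallModels.satisfiable_iff (hT : HasSmallModels T) (hφ : φ.IsQF) :
    Satisfiable T φ ↔ ∃ N < formulaCode φ + 1, HasModelOfCard T φ (N + 1) := by
  constructor
  · rintro ⟨A, hA, h⟩
    obtain ⟨N, hN, -, hmodel⟩ := hT φ hφ A hA h
    exact ⟨N, Nat.lt_succ_of_le hN, hmodel⟩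
  · rintro ⟨N, -, hmodel⟩
    exact hmodel.satisfiable

theorem HasSmallModels.isDecidable (hT : HasSmallModels T) (hqf : PrimrecPred (IsQFCode L))
    {p : ℕ → ℕ → Prop} (hp : PrimrecRel p)
    (h : ∀ φ : L.Formula ℕ, φ.IsQF → ∀ N, HasModelOfCard T φ (N + 1) ↔ p N (formulaCode φ)) :
    IsDecidable T :=
  isDecidable_of_primrecPred hqf (hp.exists_lt.comp Primrec.succ Primrec.id) fun φ hφ => by
    simp only [hT.satisfiable_iff hφ, h φ hφ, Nat.succ_eq_add_one, id_eq]

theorem HasSmallModels.hasComputableMinimalModelFunction (hT : HasSmallModels T)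
    {p : ℕ → ℕ → Prop} (hp : PrimrecRel p)
    (h : ∀ φ : L.Formula ℕ, φ.IsQF → ∀ N, HasModelOfCard T φ (N + 1) ↔ p N (formulaCode φ)) :
    HasComputableMinimalModelFunction T := by
  obtain ⟨_, hdec⟩ : PrimrecPred fun cN : ℕ × ℕ => p cN.2 cN.1 :=
    hp.comp Primrec.snd Primrec.fst
  let least (c : ℕ) : ℕ := (List.range (c + 1)).findIdx fun N => decide (p (c, N).2 (c, N).1)
  have hleast : Primrec least :=
    Primrec.list_findIdx (Primrec.list_range.comp Primrec.succ) hdec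
  refine ⟨fun φ => (least (formulaCode φ.1) + 1 : ℕ), ?_, fun c => (least c + 1 : ℕ),
    (Primrec.option_some.comp (Primrec.succ.comp hleast)).to_comp, fun _ => rfl⟩
  rintro ⟨φ, hφ⟩ hsat
  obtain ⟨N, hN, hmodel⟩ := (hT.satisfiable_iff hφ).1 hsat
  have hlt : least (formulaCode φ) < (List.range (formulaCode φ + 1)).length :=
    List.findIdx_lt_length_of_exists ⟨N, List.mem_range.2 hN, decide_eq_true ((h φ hφ N).1 hmodel)⟩
  have hp_least : p (least (formulaCode φ)) (formulaCode φ) := by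
    simpa only [List.getElem_range, decide_eq_true_iff] using List.findIdx_getElem (w := hlt)
  refine ⟨(h φ hφ _).2 hp_least, fun B hB hBφ => ?_⟩
  obtain ⟨K, -, hK, hKmodel⟩ := hT φ hφ B hB hBφ
  refine le_trans (Nat.cast_le.2 (Nat.succ_le_succ (not_lt.1 fun hKlt => ?_))) hK
  have hnot := List.not_of_lt_findIdx hKlt
  simp only [List.getElem_range, decide_eq_false_iff_not] at hnot
  exact hnot ((h φ hφ K).1 hKmodel)

end HasSmallModels

/-! ### Truth of the cardinality formulas -/

section Cardinality

theorem exists_injective_range_eq_iff {M : Type*} {s : Set M} {n : ℕ} :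
    (∃ xs : Fin n → M, Function.Injective xs ∧ Set.range xs = s) ↔ s.encard = n := by
  constructor
  · rintro ⟨xs, hxs, rfl⟩
    simp [← Set.image_univ, hxs.encard_image]
  · intro h
    have hs : s.Finite := Set.finite_of_encard_eq_coe h
    have := hs.to_subtype
    have hcard : Nat.card s = n := by
      rw [Nat.card_coe_set_eq, Set.ncard, h, ENat.toNat_natCast]
    let e := Finite.equivFinOfCardEq hcard
    refine ⟨fun i => e.symm i, Subtype.val_injective.comp e.symm.injective, ?_⟩
    exact (e.symm.surjective.range_comp _).trans Subtype.range_coe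

variable {L : FirstOrder.Language.{0, 0}} {M : Type} [L.Structure M]

theorem realize_distinct {n : ℕ} {v : Empty → M} {xs : Fin n → M} :
    (distinct (L := L) n).Realize v xs ↔ Function.Injective xs := by
  simp only [distinct, BoundedFormula.realize_iInf, BoundedFormula.realize_not,
    BoundedFormula.realize_bdEqual, Function.comp_apply, Term.realize_var, Sum.elim_inr,
    Subtype.forall, Prod.forall]
  refine ⟨fun h i j hij => ?_, fun h i j hlt hij => hlt.ne (h hij)⟩
  by_contra hne
  rcases lt_or_gt_of_ne hne with hlt | hlt
  · exact h i j hlt hij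
  · exact h j i hlt hij.symm

theorem realize_cardExactly {n : ℕ} : M ⊨ (cardExactly n : L.Sentence) ↔ Cardinal.mk M = n := by
  have hatLeast : M ⊨ (cardAtLeast n : L.Sentence) ↔ ∃ xs : Fin n → M, Function.Injective xs := by
    rw [Sentence.Realize, cardAtLeast, BoundedFormula.realize_exs]
    simp only [realize_distinct]
  have hatMost : M ⊨ (cardAtMost n : L.Sentence) ↔ ∃ xs : Fin n → M, Function.Surjective xs := by
    rw [Sentence.Realize, cardAtMost, BoundedFormula.realize_exs]
    simp [Function.Surjective, eq_comm]
  rw [Sentence.Realize, cardExactly, Formula.realize_inf, ← Sentence.Realize, ← Sentence.Realize,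
    hatLeast, hatMost, ← Cardinal.mk_fin]
  constructor
  · rintro ⟨⟨xs, hxs⟩, ys, hys⟩
    exact (Cardinal.mk_le_of_surjective hys).antisymm (Cardinal.mk_le_of_injective hxs)
  · intro h
    obtain ⟨e⟩ := Cardinal.eq.1 h
    exact ⟨⟨e.symm, e.symm.injective⟩, e.symm, e.symm.surjective⟩

variable {p : ∀ {k : ℕ}, L.Term (Empty ⊕ Fin k) → L.BoundedFormula Empty k} {s : Set M}

theorem realize_countGe
    (hp : ∀ (k : ℕ) (t : L.Term (Empty ⊕ Fin k)) (v : Empty → M) (xs : Fin k → M),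
      (p t).Realize v xs ↔ t.realize (Sum.elim v xs) ∈ s) {n : ℕ} :
    M ⊨ countGe p n ↔ (n : ℕ∞) ≤ s.encard := by
  rw [Sentence.Realize, countGe, BoundedFormula.realize_exs]
  simp only [BoundedFormula.realize_inf, realize_distinct, BoundedFormula.realize_iInf, hp,
    Function.comp_apply, Term.realize_var, Sum.elim_inr]
  constructor
  · rintro ⟨xs, hinj, hmem⟩
    rw [← exists_injective_range_eq_iff.1 ⟨xs, hinj, rfl⟩]
    exact Set.encard_le_encard (Set.range_subset_iff.2 hmem)
  · intro h
    obtain ⟨t, hts, ht⟩ := Set.exists_subset_encard_eq h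
    obtain ⟨xs, hinj, rfl⟩ := exists_injective_range_eq_iff.2 ht
    exact ⟨xs, hinj, Set.range_subset_iff.1 hts⟩

theorem realize_countEq
    (hp : ∀ (k : ℕ) (t : L.Term (Empty ⊕ Fin k)) (v : Empty → M) (xs : Fin k → M),
      (p t).Realize v xs ↔ t.realize (Sum.elim v xs) ∈ s) {n : ℕ} :
    M ⊨ countEq p n ↔ s.encard = n := by
  rw [Sentence.Realize, countEq, BoundedFormula.realize_exs, ← exists_injective_range_eq_iff]
  simp only [BoundedFormula.realize_inf, realize_distinct, BoundedFormula.realize_iInf, hp,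
    Function.comp_apply, Term.realize_var, Sum.elim_inr, BoundedFormula.realize_all,
    BoundedFormula.realize_imp, BoundedFormula.realize_iSup, BoundedFormula.realize_bdEqual,
    Fin.snoc_last, Fin.snoc_castSucc]
  refine exists_congr fun xs => ?_
  rw [and_assoc, Set.Subset.antisymm_iff, Set.range_subset_iff]
  simp only [Set.subset_def, Set.mem_range, eq_comm]

end Cardinality

/-! ### Functions into finite sets, coded by numbers -/

section Digits

/-- The function `ℕ → Fin (N + 1)` coded by `m`: its values are the base `N + 1` digits of `m`. -/
def digits (N m x : ℕ) : Fin (N + 1) :=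
  Fin.ofNat (N + 1) (m / (N + 1) ^ x)

theorem exists_digits_eq {N : ℕ} (w : ℕ → Fin (N + 1)) (k : ℕ) :
    ∃ m < (N + 1) ^ k, ∀ x < k, digits N m x = w x := by
  refine ⟨finFunctionFinEquiv fun i : Fin k => w i, Fin.is_lt _, fun x hx => Fin.ext ?_⟩
  rw [digits, Fin.val_ofNat, ← finFunctionFinEquiv_symm_apply_val _ ⟨x, hx⟩,
    Equiv.symm_apply_apply]

theorem primrecPred_exists_lt {α : Type*} [Primcodable α] {R : ℕ → α → Prop} (hR : PrimrecRel R)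
    {b : α → ℕ} (hb : Primrec b) : PrimrecPred fun a => ∃ x < b a, R x a :=
  (hR.exists_mem_list.comp (Primrec.list_range.comp hb) Primrec.id).of_eq (by simp)

theorem primrec_pow : Primrec₂ fun a b : ℕ => a ^ b :=
  Primrec₂.unpaired'.1 Nat.Primrec.pow

theorem primrec_digits {α : Type*} [Primcodable α] {N m x : α → ℕ} (hN : Primrec N) (hm : Primrec m)
    (hx : Primrec x) : Primrec fun a => (digits (N a) (m a) (x a) : ℕ) :=
  Primrec.nat_mod.comp
    (Primrec.nat_div.comp hm (primrec_pow.comp (Primrec.succ.comp hN) hx)) (Primrec.succ.comp hN)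

end Digits

/-! ### Small models of `T_=` -/

section Teq

/-- The truth of `Pₙ` in a `Σ_P`-interpretation. -/
def Interpretation.HoldsP (A : Interpretation sigmaP) (n : ℕ+) : Prop :=
  A.HoldsAtom (pSymbol n) ![]

theorem isModelOf_Teq_iff {A : Interpretation sigmaP} :
    A.IsModelOf Teq ↔ ∀ n : ℕ+, A.HoldsP n → Cardinal.mk A.dom = (n : ℕ) := by
  let := A.str
  simp only [Interpretation.IsModelOf, Theory.model_iff, Teq, Set.forall_mem_range]
  refine forall_congr' fun n => ?_
  rw [← realize_cardExactly (L := sigmaP), Sentence.Realize, Formula.Realize,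
    BoundedFormula.realize_imp]
  exact imp_congr_left (iff_of_eq (congrArg (Structure.RelMap (pSymbol n)) (Subsingleton.elim _ _)))

/-- The interpretation of the symbols of `Σ_P` for which `Pₙ` is true just if `n = b`; for `b = 0`
none of these symbols is true. -/
@[reducible]
def pStructure (M : Type) (b : ℕ) : sigmaP.Structure M where
  funMap f := (f : Empty).elim
  RelMap {n} R _ :=
    match n, R with
    | 0, (k : ℕ+) => (k : ℕ) = b
    | _ + 1, R => (R : Empty).elim

theorem holdsP_pStructure {M : Type} {b : ℕ} {v : ℕ → M} {n : ℕ+} :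
    (⟨M, pStructure M b, v⟩ : Interpretation sigmaP).HoldsP n ↔ (n : ℕ) = b :=
  Iff.rfl

theorem not_holdsP_pStructure_zero {M : Type} {v : ℕ → M} (n : ℕ+) :
    ¬ (⟨M, pStructure M 0, v⟩ : Interpretation sigmaP).HoldsP n :=
  n.pos.ne'

theorem isModelOf_Teq_pStructure {M : Type} {b : ℕ} {v : ℕ → M}
    (hb : b = 0 ∨ Cardinal.mk M = b) :
    (⟨M, pStructure M b, v⟩ : Interpretation sigmaP).IsModelOf Teq := by
  refine isModelOf_Teq_iff.2 fun n hn => ?_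
  rw [holdsP_pStructure] at hn
  rcases hb with rfl | hb
  · exact absurd hn n.pos.ne'
  · rw [hn, hb]

theorem sigmaP_term_eq_var (t : sigmaP.Term (ℕ ⊕ Fin 0)) : ∃ x : ℕ, t = .var (Sum.inl x) := by
  rcases t with (x | i) | ⟨f, _⟩
  · exact ⟨x, rfl⟩
  · exact i.elim0
  · exact (f : Empty).elim

theorem atomCode_pSymbol (n : ℕ+) (ts : Fin 0 → sigmaP.Term (ℕ ⊕ Fin 0)) :
    atomCode (pSymbol n) ts = Nat.pair (Nat.pair 0 n.natPred) 0 :=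
  rfl

theorem sigmaP_relation_cases
    {P : ∀ n, sigmaP.Relations n → (Fin n → sigmaP.Term (ℕ ⊕ Fin 0)) → Prop}
    (h : ∀ n : ℕ+, P 0 (pSymbol n) ![]) : ∀ n R ts, P n R ts
  | 0, (n : ℕ+), ts => Subsingleton.elim ![] ts ▸ h n
  | _ + 1, R, _ => (R : Empty).elim

theorem isTermCode_sigmaP_iff (x : ℕ) : x % 4 = 0 ↔ IsTermCode sigmaP x := by
  constructor
  · exact fun h => ⟨.var (Sum.inl (x / 4)), by rw [termCode_var]; omega⟩
  · rintro ⟨t, rfl⟩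
    obtain ⟨x, rfl⟩ := sigmaP_term_eq_var t
    rw [termCode_var, Nat.mul_mod_right]

theorem isAtomCode_sigmaP_iff (x : ℕ) :
    x.unpair.1.unpair.1 = 0 ∧ x.unpair.2 = 0 ↔ IsAtomCode sigmaP x := by
  constructor
  · rintro ⟨harity, hargs⟩
    refine ⟨0, pSymbol x.unpair.1.unpair.2.succPNat, ![], ?_⟩
    have hsymb : Nat.pair 0 x.unpair.1.unpair.2 = x.unpair.1 := by
      rw [← harity, Nat.pair_unpair]
    rw [atomCode_pSymbol, Nat.natPred_succPNat, hsymb, ← hargs, Nat.pair_unpair]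
  · rintro ⟨n, R, ts, rfl⟩
    induction n, R, ts using sigmaP_relation_cases with
    | h n => simp only [atomCode_pSymbol, Nat.unpair_pair, and_self]

theorem primrecPred_isQFCode_sigmaP : PrimrecPred (IsQFCode sigmaP) := by
  refine primrecPred_isQFCode ?_ ?_
  · exact (Primrec.eq.comp (Primrec.nat_mod.comp Primrec.id (Primrec.const 4))
      (Primrec.const 0)).of_eq isTermCode_sigmaP_iff
  · have harity : Primrec fun x : ℕ => x.unpair.1.unpair.1 :=
      Primrec.fst.comp (Primrec.unpair.comp (Primrec.fst.comp Primrec.unpair))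
    exact ((Primrec.eq.comp harity (Primrec.const 0)).and
      (Primrec.eq.comp (Primrec.snd.comp Primrec.unpair) (Primrec.const 0))).of_eq
        isAtomCode_sigmaP_iff

theorem satisfies_sigmaP_iff_of_agree {A B : Interpretation sigmaP} {φ : sigmaP.Formula ℕ}
    (hφ : φ.IsQF)
    (hval : ∀ x y, x < formulaCode φ → y < formulaCode φ → (A.val x = A.val y ↔ B.val x = B.val y))
    (hP : ∀ n : ℕ+, (n : ℕ) ≤ formulaCode φ → (A.HoldsP n ↔ B.HoldsP n)) :
    A.Satisfies φ ↔ B.Satisfies φ := by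
  refine satisfies_iff_of_agree hφ (fun t u ht hu => ?_) fun {n} R ts h => ?_
  · obtain ⟨x, rfl⟩ := sigmaP_term_eq_var t
    obtain ⟨y, rfl⟩ := sigmaP_term_eq_var u
    rw [termCode_var] at ht hu
    exact hval x y (by omega) (by omega)
  · induction n, R, ts using sigmaP_relation_cases with
    | h n =>
      refine hP n ?_
      rw [atomCode_pSymbol] at h
      rw [← n.natPred_add_one]
      exact ((Nat.right_le_pair _ _).trans (Nat.left_le_pair _ _)).trans_lt h

/-- The truth value, as a function of the Gödel number, of a quantifier-free formula in the
`Σ_P`-interpretation with domain `Fin (N + 1)` whose only true predicate symbol is `P_b` and whose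
values of the variables are coded by `m`. -/
def evalCodeP (N b m c : ℕ) : Bool :=
  evalCode (fun t u => decide (digits N m (t / 4) = digits N m (u / 4)))
    (fun x => decide (x.unpair.1.unpair.2 + 1 = b)) c

theorem evalCodeP_formulaCode {N b m : ℕ} {φ : sigmaP.Formula ℕ} (hφ : φ.IsQF) :
    evalCodeP N b m (formulaCode φ) = true ↔
      (⟨Fin (N + 1), pStructure _ b, digits N m⟩ : Interpretation sigmaP).Satisfies φ := by
  refine evalCode_formulaCode (fun t u => ?_) (fun {n} R ts => ?_) hφ
  · obtain ⟨x, rfl⟩ := sigmaP_term_eq_var t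
    obtain ⟨y, rfl⟩ := sigmaP_term_eq_var u
    rw [termCode_var, termCode_var, Nat.mul_div_cancel_left _ four_pos,
      Nat.mul_div_cancel_left _ four_pos, decide_eq_true_iff]
    rfl
  · induction n, R, ts using sigmaP_relation_cases with
    | h n =>
      rw [decide_eq_true_iff, atomCode_pSymbol, Nat.unpair_pair, Nat.unpair_pair,
        n.natPred_add_one]
      exact Iff.rfl

theorem primrec_evalCodeP :
    Primrec₂ fun (p : ℕ × ℕ × ℕ) c => evalCodeP p.1 p.2.1 p.2.2 c := by
  have hb : Primrec fun p : ℕ × ℕ × ℕ => p.2.1 := Primrec.fst.comp Primrec.snd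
  have hm : Primrec fun p : ℕ × ℕ × ℕ => p.2.2 := Primrec.snd.comp Primrec.snd
  have hdigit {t : (ℕ × ℕ × ℕ) × ℕ × ℕ → ℕ} (ht : Primrec t) :
      Primrec fun p => (digits p.1.1 p.1.2.2 (t p / 4) : ℕ) :=
    primrec_digits (Primrec.fst.comp Primrec.fst) (hm.comp Primrec.fst)
      (Primrec.nat_div.comp ht (Primrec.const 4))
  have heq : PrimrecPred fun p : (ℕ × ℕ × ℕ) × ℕ × ℕ =>
      digits p.1.1 p.1.2.2 (p.2.1 / 4) = digits p.1.1 p.1.2.2 (p.2.2 / 4) :=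
    (Primrec.eq.comp (hdigit (Primrec.fst.comp Primrec.snd))
      (hdigit (Primrec.snd.comp Primrec.snd))).of_eq fun _ => Fin.ext_iff.symm
  have hindex : Primrec fun p : (ℕ × ℕ × ℕ) × ℕ => p.2.unpair.1.unpair.2 + 1 :=
    Primrec.succ.comp (Primrec.snd.comp (Primrec.unpair.comp (Primrec.fst.comp
      (Primrec.unpair.comp Primrec.snd))))
  have hrel : PrimrecRel fun (p : ℕ × ℕ × ℕ) (x : ℕ) => x.unpair.1.unpair.2 + 1 = p.2.1 :=
    Primrec.eq.comp hindex (hb.comp Primrec.fst)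
  exact primrec_evalCode heq.decide hrel.decide

theorem hasModelOfCard_Teq_iff {φ : sigmaP.Formula ℕ} (hφ : φ.IsQF) (N : ℕ) :
    HasModelOfCard Teq φ (N + 1) ↔ ∃ m < (N + 1) ^ formulaCode φ,
      evalCodeP N 0 m (formulaCode φ) = true ∨ evalCodeP N (N + 1) m (formulaCode φ) = true := by
  simp only [evalCodeP_formulaCode hφ, hasModelOfCard_iff_exists_fin]
  constructor
  · rintro ⟨S, v, hT, h⟩
    obtain ⟨m, hm, hv⟩ := exists_digits_eq v (formulaCode φ)
    have hval : ∀ x y, x < formulaCode φ → y < formulaCode φ →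
        (digits N m x = digits N m y ↔ v x = v y) := fun x y hx hy => by rw [hv x hx, hv y hy]
    have hcard (n : ℕ+) (hn : (⟨Fin (N + 1), S, v⟩ : Interpretation sigmaP).HoldsP n) :
        (n : ℕ) = N + 1 := by
      exact_mod_cast ((Cardinal.mk_fin _).symm.trans (isModelOf_Teq_iff.1 hT n hn)).symm
    refine ⟨m, hm, ?_⟩
    by_cases hP : (⟨Fin (N + 1), S, v⟩ : Interpretation sigmaP).HoldsP N.succPNat
    · refine .inr ((satisfies_sigmaP_iff_of_agree hφ hval fun n _ => ⟨fun hn => ?_, hcard n⟩).2 h)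
      rwa [PNat.eq (m := n) (n := N.succPNat) hn]
    · refine .inl ((satisfies_sigmaP_iff_of_agree hφ hval fun n _ =>
        iff_of_false (not_holdsP_pStructure_zero n) fun hn => hP ?_).2 h)
      rwa [← PNat.eq (m := n) (n := N.succPNat) (hcard n hn)]
  · rintro ⟨m, -, h | h⟩
    · exact ⟨_, _, isModelOf_Teq_pStructure (.inl rfl), h⟩
    · exact ⟨_, _, isModelOf_Teq_pStructure (.inr (Cardinal.mk_fin _)), h⟩

theorem primrecRel_exists_evalCodeP : PrimrecRel fun N c => ∃ m < (N + 1) ^ c,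
    evalCodeP N 0 m c = true ∨ evalCodeP N (N + 1) m c = true := by
  have hN : Primrec fun p : ℕ × ℕ × ℕ => p.2.1 := Primrec.fst.comp Primrec.snd
  have hc : Primrec fun p : ℕ × ℕ × ℕ => p.2.2 := Primrec.snd.comp Primrec.snd
  have heval {b : ℕ × ℕ × ℕ → ℕ} (hb : Primrec b) :
      PrimrecPred fun p : ℕ × ℕ × ℕ => evalCodeP p.2.1 (b p) p.1 p.2.2 = true :=
    Primrec.eq.comp
      (primrec_evalCodeP.comp (hN.pair (hb.pair Primrec.fst)) hc) (Primrec.const true)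
  have hbody : PrimrecRel fun (m : ℕ) (p : ℕ × ℕ) =>
      evalCodeP p.1 0 m p.2 = true ∨ evalCodeP p.1 (p.1 + 1) m p.2 = true :=
    (heval (Primrec.const 0)).or (heval (Primrec.succ.comp hN))
  have hbound : Primrec fun p : ℕ × ℕ => (p.1 + 1) ^ p.2 :=
    primrec_pow.comp (Primrec.succ.comp Primrec.fst) Primrec.snd
  exact primrecPred_exists_lt hbody hbound

theorem hasSmallModels_Teq : HasSmallModels Teq := by
  intro φ hφ A hA h
  by_cases hP : ∃ n : ℕ+, (n : ℕ) ≤ formulaCode φ ∧ A.HoldsP n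
  · obtain ⟨n, hn, hPn⟩ := hP
    have hcard : Cardinal.mk A.dom = (n.natPred + 1 : ℕ) := by
      rw [n.natPred_add_one, isModelOf_Teq_iff.1 hA n hPn]
    exact ⟨n.natPred, (Nat.pred_le _).trans hn, hcard.ge, A, hA, h, hcard⟩
  · let B : Interpretation sigmaP := ⟨A.dom, pStructure A.dom 0, A.val⟩
    have hB : B.Satisfies φ :=
      (satisfies_sigmaP_iff_of_agree (A := B) (B := A) hφ (fun _ _ _ _ => Iff.rfl) fun n hn =>
        iff_of_false (not_holdsP_pStructure_zero n) fun hPn => hP ⟨n, hn, hPn⟩).2 h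
    obtain ⟨V, v₀, N, hN, hcard, hV⟩ := exists_restrict_satisfies hφ hB
    have hBV : (B.restrict V v₀).IsModelOf Teq :=
      isModelOf_Teq_iff.2 fun n hn => absurd hn n.pos.ne'
    exact ⟨N, hN, hcard ▸ Cardinal.mk_set_le V, _, hBV, hV, hcard⟩

theorem isDecidable_Teq : IsDecidable Teq :=
  hasSmallModels_Teq.isDecidable primrecPred_isQFCode_sigmaP primrecRel_exists_evalCodeP
    fun _ hφ => hasModelOfCard_Teq_iff hφ

theorem hasComputableMinimalModelFunction_Teq : HasComputableMinimalModelFunction Teq :=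
  hasSmallModels_Teq.hasComputableMinimalModelFunction primrecRel_exists_evalCodeP
    fun _ hφ => hasModelOfCard_Teq_iff hφ

theorem not_isSmooth_Teq : ¬ IsSmooth Teq := by
  intro hsmooth
  let A : Interpretation sigmaP := ⟨Fin 1, pStructure (Fin 1) 1, fun _ => 0⟩
  have hA : A.IsModelOf Teq := isModelOf_Teq_pStructure (.inr (Cardinal.mk_fin 1))
  obtain ⟨B, hB, hP, hcard⟩ := hsmooth (.rel (pSymbol 1) ![]) (.of_isAtomic (.rel _ _)) A hA
    (show A.HoldsP 1 from rfl) 2 (by simp [A])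
  have := isModelOf_Teq_iff.1 hB 1 hP
  simp [hcard] at this

end Teq

/-! ### Terms of `Σ_s` and their codes -/

section SigmaS

/-- The term `s(t)`. -/
def sTerm {α : Type} (t : sigmaS.Term α) : sigmaS.Term α :=
  .func sSymbol ![t]

/-- The interpretation of `s`. -/
def sMap {M : Type} [sigmaS.Structure M] (x : M) : M :=
  Structure.funMap sSymbol ![x]

/-- The interpretation of `s` in a `Σ_s`-interpretation. -/
def Interpretation.sMap (A : Interpretation sigmaS) : A.dom → A.dom :=
  letI := A.str
  TheoryCombination.sMap

/-- The interpretation of the symbols of `Σ_s` that interprets `s` as `g`. -/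
@[reducible]
def sStructure {M : Type} (g : M → M) : sigmaS.Structure M where
  funMap {n} f xs :=
    match n, f, xs with
    | 0, f, _ => (f : Empty).elim
    | 1, _, xs => g (xs 0)
    | _ + 2, f, _ => (f : Empty).elim
  RelMap R := (R : Empty).elim

theorem realize_sTerm {M α : Type} [sigmaS.Structure M] (t : sigmaS.Term α) (v : α → M) :
    (sTerm t).realize v = sMap (t.realize v) := by
  rw [sTerm, Term.realize_func]
  exact congrArg _ (funext (Fin.forall_fin_one.2 rfl))

theorem eval_sTerm (A : Interpretation sigmaS) (t : sigmaS.Term (ℕ ⊕ Fin 0)) :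
    A.eval (sTerm t) = A.sMap (A.eval t) :=
  let := A.str
  realize_sTerm t _

theorem sigmaS_term_induction {P : sigmaS.Term (ℕ ⊕ Fin 0) → Prop}
    (var : ∀ x : ℕ, P (.var (Sum.inl x))) (app : ∀ t, P t → P (sTerm t))
    (t : sigmaS.Term (ℕ ⊕ Fin 0)) : P t := by
  induction t with
  | var a =>
    obtain x | i := a
    · exact var x
    · exact i.elim0
  | @func n f ts ih =>
    match n, f with
    | 0, f => exact (f : Empty).elim
    | 1, _ =>
      have hts : ![ts 0] = ts := funext (Fin.forall_fin_one.2 rfl)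
      exact hts ▸ app (ts 0) (ih 0)
    | _ + 2, f => exact (f : Empty).elim

/-- The Gödel number of `s(t)` as a function of that of `t`. -/
def sCode (u : ℕ) : ℕ :=
  2 * Nat.pair (Nat.pair 1 0) (Nat.pair u 0 + 1) + 1

/-- The left inverse of `sCode`. -/
def sArgCode (n : ℕ) : ℕ :=
  ((n / 2).unpair.2 - 1).unpair.1

theorem termCode_sTerm (t : sigmaS.Term (ℕ ⊕ Fin 0)) :
    termCode (sTerm t) = sCode (termCode t) := by
  rw [sTerm, termCode, List.ofFn_succ, List.ofFn_zero]
  rfl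

theorem sArgCode_sCode (u : ℕ) : sArgCode (sCode u) = u := by
  have hdiv : sCode u / 2 = Nat.pair (Nat.pair 1 0) (Nat.pair u 0 + 1) := by
    rw [sCode]
    omega
  simp [sArgCode, hdiv]

theorem lt_sCode (u : ℕ) : u < sCode u := by
  have hu := Nat.left_le_pair u 0
  have hpair := Nat.right_le_pair (Nat.pair 1 0) (Nat.pair u 0 + 1)
  rw [sCode]
  omega

theorem sCode_mod_four_ne_zero (u : ℕ) : sCode u % 4 ≠ 0 := by
  rw [sCode]
  omega

theorem primrec_sCode : Primrec sCode :=
  Primrec.succ.comp (Primrec.nat_mul.comp (Primrec.const 2)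
    (Primrec₂.natPair.comp (Primrec.const _)
      (Primrec.succ.comp (Primrec₂.natPair.comp Primrec.id (Primrec.const 0)))))

theorem primrec_sArgCode : Primrec sArgCode :=
  Primrec.fst.comp (Primrec.unpair.comp (Primrec.nat_sub.comp
    (Primrec.snd.comp (Primrec.unpair.comp (Primrec.nat_div.comp Primrec.id (Primrec.const 2))))
    (Primrec.const 1)))

section TermFold

variable {α σ : Type*}

/-- The step of the course-of-values recursion `sTermFold`. -/
def sTermFoldStep (d : σ) (var : ℕ → σ) (app : σ → σ) (l : List σ) : σ :=
  if l.length % 4 = 0 then var (l.length / 4)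
  else if l.length = sCode (sArgCode l.length) then app (l.getD (sArgCode l.length) d)
  else d

/-- Structural recursion on terms of `Σ_s`, carried out on their Gödel numbers; numbers that are not
of the form `4 * x` or `sCode u` are sent to `d`. -/
def sTermFold (d : σ) (var : ℕ → σ) (app : σ → σ) (n : ℕ) : σ :=
  courseOfValues (sTermFoldStep d var app) n

theorem primrec_sTermFold [Primcodable α] [Primcodable σ] (d : σ) {var : α → ℕ → σ}
    {app : α → σ → σ} (hvar : Primrec₂ var) (happ : Primrec₂ app) :
    Primrec₂ fun a n => sTermFold d (var a) (app a) n := by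
  refine primrec_courseOfValues ?_
  have hlen : Primrec fun p : α × List σ => p.2.length := Primrec.list_length.comp Primrec.snd
  have harg := primrec_sArgCode.comp hlen
  exact Primrec.ite
    (Primrec.eq.comp (Primrec.nat_mod.comp hlen (Primrec.const 4)) (Primrec.const 0))
    (hvar.comp Primrec.fst (Primrec.nat_div.comp hlen (Primrec.const 4))) <|
    Primrec.ite (Primrec.eq.comp hlen (primrec_sCode.comp harg))
      (happ.comp Primrec.fst ((Primrec.list_getD d).comp Primrec.snd harg)) (Primrec.const d)

variable (d : σ) (var : ℕ → σ) (app : σ → σ)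

theorem sTermFold_var (x : ℕ) : sTermFold d var app (4 * x) = var x := by
  rw [sTermFold, courseOfValues_eq]
  simp [sTermFoldStep]

theorem sTermFold_sCode (u : ℕ) :
    sTermFold d var app (sCode u) = app (sTermFold d var app u) := by
  rw [sTermFold, courseOfValues_eq, sTermFoldStep]
  simp only [List.length_map, List.length_range, sCode_mod_four_ne_zero, if_false, sArgCode_sCode,
    if_true, getD_map_range _ _ (lt_sCode u)]
  rfl

theorem sTermFold_of_ne {n : ℕ} (hvar : n % 4 ≠ 0) (happ : n ≠ sCode (sArgCode n)) :
    sTermFold d var app n = d := by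
  rw [sTermFold, courseOfValues_eq, sTermFoldStep]
  simp only [List.length_map, List.length_range, hvar, if_false, if_neg happ]

end TermFold

theorem sTermFold_eq_true_iff_isTermCode (n : ℕ) :
    sTermFold false (fun _ => true) id n = true ↔ IsTermCode sigmaS n := by
  constructor
  · induction n using Nat.strong_induction_on with
    | _ n ih =>
    intro h
    by_cases hvar : n % 4 = 0
    · exact ⟨.var (Sum.inl (n / 4)), by rw [termCode_var]; omega⟩
    by_cases happ : n = sCode (sArgCode n)
    · rw [happ, sTermFold_sCode] at h
      obtain ⟨t, ht⟩ := ih (sArgCode n) (lt_of_lt_of_eq (lt_sCode _) happ.symm) h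
      exact ⟨sTerm t, by rw [termCode_sTerm, ht, ← happ]⟩
    · rw [sTermFold_of_ne _ _ _ hvar happ] at h
      exact absurd h Bool.false_ne_true
  · rintro ⟨t, rfl⟩
    induction t using sigmaS_term_induction with
    | var x => rw [termCode_var, sTermFold_var]
    | app t ih => rwa [termCode_sTerm, sTermFold_sCode]

theorem not_isAtomCode_sigmaS (x : ℕ) : ¬ IsAtomCode sigmaS x
  | ⟨_, R, _⟩ => (R : Empty).elim

theorem primrecPred_isQFCode_sigmaS : PrimrecPred (IsQFCode sigmaS) := by
  refine primrecPred_isQFCode ?_ ?_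
  · have hfold := primrec_sTermFold (α := Unit) false (var := fun _ _ => true) (app := fun _ => id)
      (Primrec.const true) Primrec.snd
    exact (Primrec.eq.comp (hfold.comp (Primrec.const ()) Primrec.id) (Primrec.const true)).of_eq
      sTermFold_eq_true_iff_isTermCode
  · exact (PrimrecPred.not (Primrec.eq.comp (Primrec.id (α := ℕ)) Primrec.id)).of_eq fun x =>
      iff_of_false (not_not_intro rfl) (not_isAtomCode_sigmaS x)

theorem map_eval_of_semiconj {A B : Interpretation sigmaS} {h : A.dom → B.dom}
    (hs : Function.Semiconj h A.sMap B.sMap) {c : ℕ} (hval : ∀ x < c, h (A.val x) = B.val x)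
    (t : sigmaS.Term (ℕ ⊕ Fin 0)) (ht : termCode t < c) : h (A.eval t) = B.eval t := by
  induction t using sigmaS_term_induction with
  | var x =>
    rw [termCode_var] at ht
    exact hval x (by omega)
  | app t ih =>
    rw [termCode_sTerm] at ht
    rw [eval_sTerm, eval_sTerm, hs, ih ((lt_sCode _).trans ht)]

theorem satisfies_iff_of_semiconj {A B : Interpretation sigmaS} {h : A.dom → B.dom}
    (hinj : Function.Injective h) (hs : Function.Semiconj h A.sMap B.sMap) {φ : sigmaS.Formula ℕ}
    (hφ : φ.IsQF) (hval : ∀ x < formulaCode φ, h (A.val x) = B.val x) :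
    A.Satisfies φ ↔ B.Satisfies φ := by
  refine satisfies_iff_of_agree hφ (fun t u ht hu => ?_) fun R => (R : Empty).elim
  rw [← map_eval_of_semiconj hs hval t ht, ← map_eval_of_semiconj hs hval u hu, hinj.eq_iff]

/-- The value, as a function of the Gödel number, of a term in the `Σ_s`-interpretation with domain
`Fin (N + 1)` whose values of the variables are coded by `m` and whose interpretation of `s` is
coded by `m'`. -/
def evalTermCodeS (N m m' : ℕ) : ℕ → ℕ :=
  sTermFold 0 (fun x => digits N m x) (fun y => digits N m' y)

/-- The truth value, as a function of the Gödel number, of a quantifier-free formula in the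
`Σ_s`-interpretation with domain `Fin (N + 1)` whose values of the variables are coded by `m` and
whose interpretation of `s` is coded by `m'`. -/
def evalCodeS (N m m' c : ℕ) : Bool :=
  evalCode (fun t u => decide (evalTermCodeS N m m' t = evalTermCodeS N m m' u)) (fun _ => false) c

theorem evalCodeS_formulaCode {N m m' : ℕ} {φ : sigmaS.Formula ℕ} (hφ : φ.IsQF) :
    evalCodeS N m m' (formulaCode φ) = true ↔
      (⟨Fin (N + 1), sStructure fun y => digits N m' y, digits N m⟩ :
        Interpretation sigmaS).Satisfies φ := by
  set A : Interpretation sigmaS := ⟨Fin (N + 1), sStructure fun y => digits N m' y, digits N m⟩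
  have heval (t : sigmaS.Term (ℕ ⊕ Fin 0)) :
      evalTermCodeS N m m' (termCode t) = ((A.eval t : Fin (N + 1)) : ℕ) := by
    induction t using sigmaS_term_induction with
    | var x =>
      rw [termCode_var, evalTermCodeS, sTermFold_var]
      rfl
    | app t ih =>
      rw [evalTermCodeS] at ih ⊢
      rw [termCode_sTerm, sTermFold_sCode, ih, eval_sTerm]
      rfl
  refine evalCode_formulaCode (fun t u => ?_) (fun R => (R : Empty).elim) hφ
  rw [decide_eq_true_iff, heval, heval]
  exact Fin.val_inj

section Primrec

variable {α : Type*} [Primcodable α] {N m m' c : α → ℕ}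

theorem primrec_evalTermCodeS (hN : Primrec N) (hm : Primrec m) (hm' : Primrec m')
    (hc : Primrec c) : Primrec fun a => evalTermCodeS (N a) (m a) (m' a) (c a) := by
  have hvar : Primrec₂ fun a x => (digits (N a) (m a) x : ℕ) :=
    primrec_digits (hN.comp Primrec.fst) (hm.comp Primrec.fst) Primrec.snd
  have happ : Primrec₂ fun a y => (digits (N a) (m' a) y : ℕ) :=
    primrec_digits (hN.comp Primrec.fst) (hm'.comp Primrec.fst) Primrec.snd
  have hfold : Primrec₂ fun a t => evalTermCodeS (N a) (m a) (m' a) t :=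
    primrec_sTermFold 0 hvar happ
  exact hfold.comp Primrec.id hc

theorem primrec_evalCodeS (hN : Primrec N) (hm : Primrec m) (hm' : Primrec m') (hc : Primrec c) :
    Primrec fun a => evalCodeS (N a) (m a) (m' a) (c a) := by
  have heval {t : α × ℕ × ℕ → ℕ} (ht : Primrec t) :
      Primrec fun q => evalTermCodeS (N q.1) (m q.1) (m' q.1) (t q) :=
    primrec_evalTermCodeS (hN.comp Primrec.fst) (hm.comp Primrec.fst) (hm'.comp Primrec.fst) ht
  have heq := Primrec.eq.comp (heval (Primrec.fst.comp Primrec.snd))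
    (heval (Primrec.snd.comp Primrec.snd))
  have hcode : Primrec₂ fun a x => evalCodeS (N a) (m a) (m' a) x :=
    primrec_evalCode heq.decide (Primrec.const false).to₂
  exact hcode.comp Primrec.id hc

end Primrec

theorem isModelOf_empty (A : Interpretation sigmaS) : A.IsModelOf ∅ :=
  letI := A.str
  Theory.model_iff _ |>.2 fun _ h => h.elim

theorem hasModelOfCard_empty_iff {φ : sigmaS.Formula ℕ} (hφ : φ.IsQF) (N : ℕ) :
    HasModelOfCard ∅ φ (N + 1) ↔ ∃ m < (N + 1) ^ formulaCode φ, ∃ m' < (N + 1) ^ (N + 1),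
      evalCodeS N m m' (formulaCode φ) = true := by
  simp only [evalCodeS_formulaCode hφ, hasModelOfCard_iff_exists_fin]
  constructor
  · rintro ⟨S, v, -, h⟩
    obtain ⟨m, hm, hv⟩ := exists_digits_eq v (formulaCode φ)
    let A : Interpretation sigmaS := ⟨Fin (N + 1), S, v⟩
    obtain ⟨m', hm', hs⟩ := exists_digits_eq (fun y => A.sMap (Fin.ofNat (N + 1) y)) (N + 1)
    refine ⟨m, hm, m', hm', (satisfies_iff_of_semiconj (A := A)
      (B := ⟨Fin (N + 1), sStructure fun y => digits N m' y, digits N m⟩) (h := id)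
      Function.injective_id (fun y => ?_) hφ fun x hx => (hv x hx).symm).1 h⟩
    exact ((hs y y.isLt).trans (congrArg A.sMap (Fin.ofNat_val_eq_self y))).symm
  · rintro ⟨m, -, m', -, h⟩
    exact ⟨_, _, isModelOf_empty _, h⟩

theorem primrecRel_exists_evalCodeS : PrimrecRel fun N c => ∃ m < (N + 1) ^ c,
    ∃ m' < (N + 1) ^ (N + 1), evalCodeS N m m' c = true := by
  have hm : Primrec fun q : ℕ × ℕ × ℕ × ℕ => q.2.1 := Primrec.fst.comp Primrec.snd
  have hN : Primrec fun q : ℕ × ℕ × ℕ × ℕ => q.2.2.1 :=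
    Primrec.fst.comp (Primrec.snd.comp Primrec.snd)
  have hc : Primrec fun q : ℕ × ℕ × ℕ × ℕ => q.2.2.2 :=
    Primrec.snd.comp (Primrec.snd.comp Primrec.snd)
  have heval : PrimrecRel fun (m' : ℕ) (p : ℕ × ℕ × ℕ) => evalCodeS p.2.1 p.1 m' p.2.2 = true :=
    Primrec.eq.comp (primrec_evalCodeS hN hm Primrec.fst hc) (Primrec.const true)
  have hN' : Primrec fun p : ℕ × ℕ × ℕ => p.2.1 + 1 :=
    Primrec.succ.comp (Primrec.fst.comp Primrec.snd)
  have hbound : Primrec fun p : ℕ × ℕ × ℕ => (p.2.1 + 1) ^ (p.2.1 + 1) := primrec_pow.comp hN' hN'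
  have hbody : PrimrecRel fun (m : ℕ) (p : ℕ × ℕ) =>
      ∃ m' < (p.1 + 1) ^ (p.1 + 1), evalCodeS p.1 m m' p.2 = true :=
    primrecPred_exists_lt heval hbound
  have hbound' : Primrec fun p : ℕ × ℕ => (p.1 + 1) ^ p.2 :=
    primrec_pow.comp (Primrec.succ.comp Primrec.fst) Primrec.snd
  exact primrecPred_exists_lt hbody hbound'

theorem hasSmallModels_empty : HasSmallModels (∅ : sigmaS.Theory) := by
  intro φ hφ A _ h
  obtain ⟨V, v₀, N, hN, hcard, hV⟩ := exists_restrict_satisfies hφ h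
  exact ⟨N, hN, hcard ▸ Cardinal.mk_set_le V, _, isModelOf_empty _, hV, hcard⟩

theorem isDecidable_empty : IsDecidable (∅ : sigmaS.Theory) :=
  hasSmallModels_empty.isDecidable primrecPred_isQFCode_sigmaS primrecRel_exists_evalCodeS
    fun _ hφ => hasModelOfCard_empty_iff hφ

end SigmaS

/-! ### Models of `T_f` -/

section CountValues

variable (f : ℕ+ → Bool)

theorem countValues_eq_count (b : Bool) (k : ℕ+) :
    countValues f b k = Nat.count (fun i => f i.succPNat = b) k := by
  rw [countValues, Nat.count_eq_card_filter_range]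
  refine Finset.card_nbij' PNat.natPred Nat.succPNat ?_ ?_ ?_ ?_
  · intro i hi
    obtain ⟨hik, hi⟩ := Finset.mem_filter.1 hi
    have hle : (i : ℕ) ≤ k := (Finset.mem_Icc.1 hik).2
    have := i.natPred_add_one
    simp only [Finset.coe_filter, Finset.mem_range, Set.mem_ofPred_eq, PNat.succPNat_natPred]
    exact ⟨by omega, hi⟩
  · intro i hi
    obtain ⟨hik, hi⟩ := Finset.mem_filter.1 hi
    exact Finset.mem_filter.2 ⟨Finset.mem_Icc.2
      ⟨one_le, PNat.coe_le_coe _ _ |>.1 (Finset.mem_range.1 hik)⟩, hi⟩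
  · exact fun i _ => i.succPNat_natPred
  · exact fun i _ => i.natPred_succPNat

theorem countValues_mono (b : Bool) : Monotone (countValues f b) := fun _ _ h =>
  Finset.card_le_card (Finset.filter_subset_filter _ (Finset.Icc_subset_Icc_right h))

theorem countValues_true_add_countValues_false (k : ℕ+) :
    countValues f true k + countValues f false k = k := by
  simpa [countValues] using
    Finset.card_filter_add_card_filter_not (s := Finset.Icc 1 k) fun i => f i = true

end CountValues

section Tf

variable {M : Type} {f : ℕ+ → Bool}

/-- The set of the fixed points of `s`. -/
abbrev fixedSet (M : Type) [sigmaS.Structure M] : Set M :=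
  Function.fixedPoints sMap

theorem realize_fixedBy [sigmaS.Structure M] (k : ℕ) (t : sigmaS.Term (Empty ⊕ Fin k))
    (v : Empty → M) (xs : Fin k → M) :
    (fixedBy t).Realize v xs ↔ t.realize (Sum.elim v xs) ∈ fixedSet M := by
  rw [fixedBy, BoundedFormula.realize_bdEqual, ← sTerm, realize_sTerm]
  rfl

theorem realize_movedBy [sigmaS.Structure M] (k : ℕ) (t : sigmaS.Term (Empty ⊕ Fin k))
    (v : Empty → M) (xs : Fin k → M) :
    (movedBy t).Realize v xs ↔ t.realize (Sum.elim v xs) ∈ (fixedSet M)ᶜ := by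
  rw [movedBy, BoundedFormula.realize_not, realize_fixedBy, Set.mem_compl_iff]

theorem model_Tf_iff [sigmaS.Structure M] :
    M ⊨ Tf f ↔ ∀ k : ℕ+,
      (countValues f true k ≤ (fixedSet M).encard ∧
        countValues f false k ≤ (fixedSet M)ᶜ.encard) ∨
      ∃ i ≤ k, (fixedSet M).encard = countValues f true i ∧
        (fixedSet M)ᶜ.encard = countValues f false i := by
  simp only [Theory.model_iff, Tf, Set.forall_mem_range]
  refine forall_congr' fun k => ?_
  rw [Sentence.Realize, axiomTf, Formula.realize_sup, Formula.realize_inf, ← Sentence.Realize,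
    ← Sentence.Realize, realize_countGe realize_fixedBy, realize_countGe realize_movedBy,
    Formula.Realize, BoundedFormula.realize_iSup]
  simp only [Subtype.exists, exists_prop]
  exact or_congr_right <| exists_congr fun i => and_congr_right fun _ =>
    BoundedFormula.realize_inf.trans <|
      and_congr (realize_countEq realize_fixedBy) (realize_countEq realize_movedBy)

theorem model_Tf_iff_of_mk_eq [sigmaS.Structure M] {n : ℕ+} (hn : Cardinal.mk M = (n : ℕ)) :
    M ⊨ Tf f ↔ (fixedSet M).encard = countValues f true n := by
  have hfin : Finite M := Cardinal.lt_aleph0_iff_finite.1 (hn ▸ Cardinal.natCast_lt_aleph0)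
  rw [model_Tf_iff]
  set s := fixedSet M
  have hcompl : s.ncard + sᶜ.ncard = n := by
    rw [Set.ncard_add_ncard_compl, Nat.card, hn, Cardinal.toNat_natCast]
  have hadd := countValues_true_add_countValues_false f
  rw [← s.toFinite.cast_ncard_eq, ← sᶜ.toFinite.cast_ncard_eq]
  norm_cast
  constructor
  · intro h
    rcases h n with ⟨hle, hle'⟩ | ⟨i, -, htrue, hfalse⟩
    · linarith [hadd n]
    · have hi : i = n := PNat.eq (by rw [← hadd i, ← htrue, ← hfalse, hcompl])
      rw [htrue, hi]
  · intro htrue k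
    have hfalse : sᶜ.ncard = countValues f false n := by linarith [hadd n]
    rw [htrue, hfalse]
    rcases le_total k n with hk | hk
    · exact .inl ⟨countValues_mono f true hk, countValues_mono f false hk⟩
    · exact .inr ⟨n, hk, rfl, rfl⟩

/-- The extension of a `Σ_s`-interpretation by infinitely many points that `s` fixes and infinitely
many points that `s` moves. -/
def Interpretation.addPoints (A : Interpretation sigmaS) : Interpretation sigmaS where
  dom := A.dom ⊕ ℕ ⊕ ℕ
  str := sStructure (Sum.map A.sMap (Sum.map id Nat.succ))
  val := Sum.inl ∘ A.val

theorem isModelOf_Tf_addPoints (A : Interpretation sigmaS) : A.addPoints.IsModelOf (Tf f) := by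
  let := A.addPoints.str
  have hfixed : (fixedSet A.addPoints.dom).encard = ⊤ :=
    Set.encard_eq_top_iff.2 (Set.infinite_of_injective_forall_mem
      (Sum.inr_injective.comp Sum.inl_injective) fun n : ℕ => rfl)
  have hmoved : (fixedSet A.addPoints.dom)ᶜ.encard = ⊤ :=
    Set.encard_eq_top_iff.2 (Set.infinite_of_injective_forall_mem
      (Sum.inr_injective.comp Sum.inr_injective) fun (n : ℕ) h =>
        n.succ_ne_self (Sum.inr_injective (Sum.inr_injective h)))
  exact model_Tf_iff.2 fun _ => .inl ⟨hfixed ▸ le_top, hmoved ▸ le_top⟩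

theorem satisfiable_empty_iff_satisfiable_Tf {φ : sigmaS.Formula ℕ} (hφ : φ.IsQF) :
    Satisfiable ∅ φ ↔ Satisfiable (Tf f) φ :=
  ⟨fun ⟨A, _, h⟩ => ⟨A.addPoints, isModelOf_Tf_addPoints A,
      (satisfies_iff_of_semiconj (A := A) (B := A.addPoints) Sum.inl_injective (fun _ => rfl)
        hφ fun _ _ => rfl).1 h⟩,
    fun ⟨A, _, h⟩ => ⟨A, isModelOf_empty A, h⟩⟩

theorem isDecidable_Tf (f : ℕ+ → Bool) : IsDecidable (Tf f) :=
  isDecidable_empty.congr fun _ hφ => satisfiable_empty_iff_satisfiable_Tf hφ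

end Tf

/-! ### Undecidability of the combination -/

section Reduct

variable {L L' : FirstOrder.Language.{0, 0}}

/-- The interpretation of the smaller signature `L` that an interpretation of `L'` induces. -/
def Interpretation.reduct (Φ : L →ᴸ L') (A : Interpretation L') : Interpretation L where
  dom := A.dom
  str := letI := A.str; Φ.reduct A.dom
  val := A.val

theorem satisfies_onFormula_iff (Φ : L →ᴸ L') {A : Interpretation L'} {φ : L.Formula ℕ} :
    A.Satisfies (Φ.onFormula φ) ↔ (A.reduct Φ).Satisfies φ :=
  let := A.str
  let : L.Structure A.dom := (A.reduct Φ).str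
  have : Φ.IsExpansionOn A.dom := Φ.isExpansionOn_reduct A.dom
  Φ.realize_onFormula φ

theorem isModelOf_onTheory_iff (Φ : L →ᴸ L') {A : Interpretation L'} {T : L.Theory} :
    A.IsModelOf (Φ.onTheory T) ↔ (A.reduct Φ).IsModelOf T :=
  let := A.str
  let : L.Structure A.dom := (A.reduct Φ).str
  have : Φ.IsExpansionOn A.dom := Φ.isExpansionOn_reduct A.dom
  Φ.onTheory_model T

theorem isModelOf_combine_iff {T : L.Theory} {T' : L'.Theory}
    {A : Interpretation (L.sum L')} :
    A.IsModelOf (combine T T') ↔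
      (A.reduct LHom.sumInl).IsModelOf T ∧ (A.reduct LHom.sumInr).IsModelOf T' :=
  let := A.str
  Theory.model_union_iff.trans (and_congr (isModelOf_onTheory_iff _) (isModelOf_onTheory_iff _))

end Reduct

section Conjunction

variable {L : FirstOrder.Language.{0, 0}}

/-- The conjunction of a list of formulas. -/
def conj (l : List (L.Formula ℕ)) : L.Formula ℕ :=
  l.foldr (· ⊓ ·) ⊤

theorem satisfies_conj_iff {A : Interpretation L} {l : List (L.Formula ℕ)} :
    A.Satisfies (conj l) ↔ ∀ φ ∈ l, A.Satisfies φ :=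
  let := A.str
  BoundedFormula.realize_foldr_inf l A.val default

theorem isQF_conj {l : List (L.Formula ℕ)} (hl : ∀ φ ∈ l, φ.IsQF) : (conj l).IsQF := by
  induction l with
  | nil => exact .top
  | cons φ l ih =>
    rw [List.forall_mem_cons] at hl
    exact hl.1.inf (ih hl.2)

/-- The Gödel number of an equation as a function of those of its sides. -/
def equalCode (t u : ℕ) : ℕ :=
  4 * Nat.pair t u + 1

/-- The Gödel number of an implication as a function of those of its sides. -/
def impCode (x y : ℕ) : ℕ :=
  4 * Nat.pair x y + 3

/-- The Gödel number of the conjunction of a list of formulas as a function of theirs. -/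
def conjCode (l : List ℕ) : ℕ :=
  l.foldr (fun x y => impCode (impCode x (impCode y 0)) 0) (impCode 0 0)

theorem formulaCode_conj [∀ n, Encodable (L.Functions n)] [∀ n, Encodable (L.Relations n)]
    (l : List (L.Formula ℕ)) : formulaCode (conj l) = conjCode (l.map formulaCode) := by
  induction l with
  | nil => rfl
  | cons φ l ih =>
    rw [List.map_cons, conjCode, List.foldr_cons, ← conjCode, ← ih]
    rfl

theorem primrec_equalCode : Primrec₂ equalCode :=
  Primrec.succ.comp (Primrec.nat_mul.comp (Primrec.const 4) Primrec₂.natPair)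

theorem primrec_impCode : Primrec₂ impCode :=
  Primrec.nat_add.comp (Primrec.nat_mul.comp (Primrec.const 4) Primrec₂.natPair) (Primrec.const 3)

theorem primrec_conjCode : Primrec conjCode := by
  have hstep : Primrec₂ fun (_ : List ℕ) (p : ℕ × ℕ) => impCode (impCode p.1 (impCode p.2 0)) 0 :=
    primrec_impCode.comp (primrec_impCode.comp (Primrec.fst.comp Primrec.snd)
      (primrec_impCode.comp (Primrec.snd.comp Primrec.snd) (Primrec.const 0))) (Primrec.const 0)
  exact Primrec.list_foldr Primrec.id (Primrec.const _) hstep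

end Conjunction

section Combination

/-- The `Σ_s ∪ Σ_P`-formula `s(x_i) = x_i`. -/
def varFixed (i : ℕ) : (sigmaS.sum sigmaP).Formula ℕ :=
  LHom.sumInl.onFormula ((sTerm (.var (Sum.inl i))).bdEqual (.var (Sum.inl i)) : sigmaS.Formula ℕ)

/-- The `Σ_s ∪ Σ_P`-formula `¬ x_i = x_j`. -/
def varNe (i j : ℕ) : (sigmaS.sum sigmaP).Formula ℕ :=
  ∼((Term.var (Sum.inl i)).bdEqual (.var (Sum.inl j)))

/-- The `Σ_s ∪ Σ_P`-formula saying that `P_n` holds and `x_0, …, x_{k - 1}` are distinct fixed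
points of `s`. -/
def sizeAndFixedPoints (n : ℕ+) (k : ℕ) : (sigmaS.sum sigmaP).Formula ℕ :=
  conj (LHom.sumInr.onFormula (.rel (pSymbol n) ![] : sigmaP.Formula ℕ) ::
    (List.range k).flatMap fun i => varFixed i :: (List.range i).map fun j => varNe j i)

theorem isQF_sizeAndFixedPoints (n : ℕ+) (k : ℕ) : (sizeAndFixedPoints n k).IsQF := by
  refine isQF_conj fun φ hφ => ?_
  simp only [List.mem_cons, List.mem_flatMap, List.mem_map] at hφ
  obtain rfl | ⟨i, -, rfl | ⟨j, -, rfl⟩⟩ := hφ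
  · exact .of_isAtomic (.rel _ _)
  · exact .of_isAtomic (.equal _ _)
  · exact .imp (.of_isAtomic (.equal _ _)) .falsum

theorem satisfies_varFixed_iff {A : Interpretation (sigmaS.sum sigmaP)} {i : ℕ} :
    A.Satisfies (varFixed i) ↔ A.val i ∈ Function.fixedPoints (A.reduct LHom.sumInl).sMap := by
  rw [varFixed, satisfies_onFormula_iff]
  let := (A.reduct LHom.sumInl).str
  refine BoundedFormula.realize_bdEqual _ _ |>.trans ?_
  rw [realize_sTerm]
  rfl

theorem satisfies_sizeAndFixedPoints_iff {A : Interpretation (sigmaS.sum sigmaP)} {n : ℕ+}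
    {k : ℕ} : A.Satisfies (sizeAndFixedPoints n k) ↔ (A.reduct LHom.sumInr).HoldsP n ∧
      Set.MapsTo A.val (Set.Iio k) (Function.fixedPoints (A.reduct LHom.sumInl).sMap) ∧
      Set.InjOn A.val (Set.Iio k) := by
  have hinj : Set.InjOn A.val (Set.Iio k) ↔ ∀ i < k, ∀ j < i, A.val j ≠ A.val i := by
    refine ⟨fun h i hi j hj hij => hj.ne (h (hj.trans hi) hi hij), fun h i hi j hj hij => ?_⟩
    by_contra hne
    rcases lt_or_gt_of_ne hne with hlt | hlt
    · exact h j hj i hlt hij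
    · exact h i hi j hlt hij.symm
  have hP : A.Satisfies (LHom.sumInr.onFormula (.rel (pSymbol n) ![] : sigmaP.Formula ℕ)) ↔
      (A.reduct LHom.sumInr).HoldsP n := satisfies_onFormula_iff _
  have hne (i j : ℕ) : A.Satisfies (varNe i j) ↔ A.val i ≠ A.val j := Iff.rfl
  rw [sizeAndFixedPoints, satisfies_conj_iff, List.forall_mem_cons, hP, hinj]
  simp only [List.mem_flatMap, List.mem_cons, List.mem_map, List.mem_range]
  refine and_congr_right fun _ => ⟨fun h => ⟨fun i hi => ?_, fun i hi j hj => ?_⟩, ?_⟩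
  · exact satisfies_varFixed_iff.1 (h _ ⟨i, hi, .inl rfl⟩)
  · exact (hne j i).1 (h _ ⟨i, hi, .inr ⟨j, hj, rfl⟩⟩)
  · rintro ⟨hfix, hdist⟩ _ ⟨i, hi, rfl | ⟨j, hj, rfl⟩⟩
    · exact satisfies_varFixed_iff.2 (hfix hi)
    · exact (hne j i).2 (hdist i hi j hj)

theorem exists_fixedPoints_eq {α : Type*} {s : Set α} (hs : s.Nonempty) :
    ∃ g : α → α, Function.fixedPoints g = s := by
  classical
  obtain ⟨x₀, hx₀⟩ := hs
  refine ⟨fun x => if x ∈ s then x else x₀, Set.ext fun x => ?_⟩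
  by_cases hx : x ∈ s
  · simp [Function.IsFixedPt, hx]
  · simp [Function.IsFixedPt, hx, (ne_of_mem_of_not_mem hx₀ hx)]

theorem satisfiable_sizeAndFixedPoints_iff {f : ℕ+ → Bool} {n : ℕ+} {k : ℕ} :
    Satisfiable (combine (Tf f) Teq) (sizeAndFixedPoints n (k + 1)) ↔
      k < countValues f true n := by
  constructor
  · rintro ⟨A, hA, h⟩
    obtain ⟨hTf, hTeq⟩ := isModelOf_combine_iff.1 hA
    obtain ⟨hP, hfix, hinj⟩ := satisfies_sizeAndFixedPoints_iff.1 h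
    let : sigmaS.Structure A.dom := (A.reduct LHom.sumInl).str
    have hcard := (model_Tf_iff_of_mk_eq (M := A.dom) (isModelOf_Teq_iff.1 hTeq n hP)).1 hTf
    have hle := Set.encard_le_encard hfix.image_subset
    rw [hinj.encard_image, ← Finset.coe_range, Set.encard_coe_eq_coe_finsetCard,
      Finset.card_range] at hle
    exact_mod_cast hle.trans_eq hcard
  · intro hk
    have hle : countValues f true n ≤ n :=
      (Nat.le_add_right _ _).trans_eq (countValues_true_add_countValues_false f n)
    let s : Set (Fin n) := Set.range (Fin.castLE hle)
    obtain ⟨g, hg⟩ := exists_fixedPoints_eq (s := s) ⟨_, ⟨k, hk⟩, rfl⟩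
    have hs : s.encard = countValues f true n :=
      exists_injective_range_eq_iff.1 ⟨_, Fin.castLE_injective hle, rfl⟩
    let := sStructure g
    let := pStructure (Fin n) n
    let A : Interpretation (sigmaS.sum sigmaP) :=
      ⟨Fin n, sigmaS.sumStructure sigmaP (Fin n), fun i => Fin.ofNat n i⟩
    have hval {i : ℕ} (hi : i < k + 1) : (A.val i : Fin n).val = i := Nat.mod_eq_of_lt (by omega)
    refine ⟨A, isModelOf_combine_iff.2 ⟨?_, ?_⟩, satisfies_sizeAndFixedPoints_iff.2 ⟨?_, ?_, ?_⟩⟩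
    · exact (model_Tf_iff_of_mk_eq (Cardinal.mk_fin n)).2 ((congrArg Set.encard hg).trans hs)
    · exact isModelOf_Teq_pStructure (.inr (Cardinal.mk_fin n))
    · exact (holdsP_pStructure (M := Fin n) (b := n)).2 rfl
    · intro i hi
      have : A.val i = Fin.castLE hle ⟨i, Nat.lt_succ_iff.1 hi |>.trans_lt hk⟩ := Fin.ext (hval hi)
      exact hg.ge ⟨_, this.symm⟩
    · exact fun i hi j hj hij => (hval hi).symm.trans (congrArg Fin.val hij |>.trans (hval hj))

end Combination

section Undecidability

/-- The Gödel number of `sizeAndFixedPoints n k` as a function of the encoding of `n` by a natural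
number and of `k`. -/
def sizeAndFixedPointsCode (n k : ℕ) : ℕ :=
  conjCode ((4 * Nat.pair (Nat.pair 0 (2 * n + 1)) 0 + 2) ::
    (List.range k).flatMap fun i => equalCode (sCode (4 * i)) (4 * i) ::
      (List.range i).map fun j => impCode (equalCode (4 * j) (4 * i)) 0)

theorem formulaCode_varFixed (i : ℕ) :
    formulaCode (varFixed i) = equalCode (sCode (4 * i)) (4 * i) := by
  have hvar : termCode (.var (Sum.inl i) : (sigmaS.sum sigmaP).Term (ℕ ⊕ Fin 0)) = 4 * i :=
    termCode_var i
  rw [← hvar]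
  rfl

theorem formulaCode_varNe (i j : ℕ) :
    formulaCode (varNe i j) = impCode (equalCode (4 * i) (4 * j)) 0 := by
  rw [← termCode_var (L := sigmaS.sum sigmaP), ← termCode_var (L := sigmaS.sum sigmaP)]
  rfl

theorem formulaCode_sizeAndFixedPoints (n k : ℕ) :
    formulaCode (sizeAndFixedPoints n.succPNat k) = sizeAndFixedPointsCode n k := by
  have hP : formulaCode (LHom.sumInr.onFormula (.rel (pSymbol n.succPNat) ![] :
      sigmaP.Formula ℕ) : (sigmaS.sum sigmaP).Formula ℕ) =
      4 * Nat.pair (Nat.pair 0 (2 * n + 1)) 0 + 2 :=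
    congrArg (fun m => 4 * Nat.pair (Nat.pair 0 (2 * m + 1)) 0 + 2) (Nat.natPred_succPNat n)
  rw [sizeAndFixedPoints, formulaCode_conj, sizeAndFixedPointsCode, List.map_cons, hP,
    List.map_flatMap]
  simp only [List.map_cons, List.map_map, Function.comp_def, formulaCode_varFixed,
    formulaCode_varNe]

theorem primrec_sizeAndFixedPointsCode : Primrec₂ sizeAndFixedPointsCode := by
  have four {α : Type} [Primcodable α] {g : α → ℕ} (hg : Primrec g) : Primrec fun a => 4 * g a :=
    Primrec.nat_mul.comp (Primrec.const 4) hg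
  have hne : Primrec₂ fun i j => impCode (equalCode (4 * j) (4 * i)) 0 :=
    primrec_impCode.comp (primrec_equalCode.comp (four Primrec.snd) (four Primrec.fst))
      (Primrec.const 0)
  have hfix : Primrec fun i => equalCode (sCode (4 * i)) (4 * i) :=
    primrec_equalCode.comp (primrec_sCode.comp (four Primrec.id)) (four Primrec.id)
  have hlits : Primrec fun i => equalCode (sCode (4 * i)) (4 * i) ::
      (List.range i).map fun j => impCode (equalCode (4 * j) (4 * i)) 0 :=
    Primrec.list_cons.comp hfix (Primrec.list_map Primrec.list_range hne)
  have hsize : Primrec fun n => 4 * Nat.pair (Nat.pair 0 (2 * n + 1)) 0 + 2 :=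
    Primrec.nat_add.comp (four (Primrec₂.natPair.comp (Primrec₂.natPair.comp (Primrec.const 0)
      (Primrec.succ.comp (Primrec.nat_mul.comp (Primrec.const 2) Primrec.id))) (Primrec.const 0)))
      (Primrec.const 2)
  exact primrec_conjCode.comp (Primrec.list_cons.comp (hsize.comp Primrec.fst)
    (Primrec.list_flatMap (Primrec.list_range.comp Primrec.snd) (hlits.comp Primrec.snd)))

theorem computable_of_computablePred_lt_count {p : ℕ → Bool}
    (hp : ComputablePred fun x : ℕ × ℕ => x.2 < Nat.count (p · = true) (x.1 + 1)) :
    Computable p := by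
  obtain ⟨d, hd, hdec⟩ := ComputablePred.computable_iff.1 hp
  have hstep (n : ℕ) : d (n, Nat.count (p · = true) n) = p n := by
    rw [Bool.eq_iff_iff, ← iff_of_eq (congrFun hdec _), Nat.count_succ]
    split_ifs with h <;> simp [h]
  have hcount : Computable (Nat.count (p · = true)) := by
    have hnext : Computable₂ fun (_ : ℕ) (x : ℕ × ℕ) => bif d x then x.2 + 1 else x.2 :=
      Computable.cond (hd.comp Computable.snd)
        (Computable.succ.comp (Computable.snd.comp Computable.snd))
        (Computable.snd.comp Computable.snd)
    refine (Computable.nat_rec Computable.id (Computable.const 0) hnext).of_eq fun n => ?_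
    induction n with
    | zero => exact (Nat.count_zero _).symm
    | succ n ih =>
      dsimp only [id] at ih ⊢
      rw [ih, hstep, Nat.count_succ]
      cases p n <;> rfl
  exact (hd.comp (Computable.id.pair hcount)).of_eq hstep

theorem computable_of_isDecidable_combine {f : ℕ+ → Bool}
    (h : IsDecidable (combine (Tf f) Teq)) : Computable f := by
  have hsat (n k : ℕ) : k < Nat.count (fun i => f i.succPNat = true) (n + 1) ↔
      ∃ φ : (sigmaS.sum sigmaP).Formula ℕ, φ.IsQF ∧ Satisfiable (combine (Tf f) Teq) φ ∧
        formulaCode φ = sizeAndFixedPointsCode n (k + 1) := by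
    rw [← Nat.succ_eq_add_one, ← Nat.succPNat_coe, ← countValues_eq_count,
      ← satisfiable_sizeAndFixedPoints_iff, ← formulaCode_sizeAndFixedPoints]
    refine ⟨fun hs => ⟨_, isQF_sizeAndFixedPoints _ _, hs, rfl⟩, ?_⟩
    rintro ⟨φ, -, hφ, hc⟩
    rwa [← formulaCode_injective hc]
  have hcode : Computable fun x : ℕ × ℕ => sizeAndFixedPointsCode x.1 (x.2 + 1) :=
    (primrec_sizeAndFixedPointsCode.comp Primrec.fst (Primrec.succ.comp Primrec.snd)).to_comp
  have hsucc : Computable fun n : ℕ => f n.succPNat := by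
    refine computable_of_computablePred_lt_count ?_
    obtain ⟨d, hd, hdec⟩ := ComputablePred.computable_iff.1 h
    refine ComputablePred.computable_iff.2 ⟨_, hd.comp hcode, funext fun x => propext ?_⟩
    exact (hsat x.1 x.2).trans (iff_of_eq (congrFun hdec _))
  refine (hsucc.comp (Computable.encode (α := ℕ+))).of_eq fun n => ?_
  exact congrArg f (PNat.succPNat_natPred n)

end Undecidability

/-! ### Existence of admissible functions -/

/-- The function on the positive integers with successive values `g 0, !g 0, g 1, !g 1, …`. -/
def interleaveNot (g : ℕ → Bool) (i : ℕ+) : Bool :=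
  if i.natPred % 2 = 0 then g (i.natPred / 2) else !g (i.natPred / 2)

theorem interleaveNot_two_mul (g : ℕ → Bool) (m : ℕ) :
    interleaveNot g (2 * m).succPNat = g m := by
  simp [interleaveNot]

theorem interleaveNot_two_mul_add_one (g : ℕ → Bool) (m : ℕ) :
    interleaveNot g (2 * m + 1).succPNat = !g m := by
  simp [interleaveNot, show (2 * m + 1) / 2 = m by omega]

theorem count_interleaveNot (g : ℕ → Bool) (b : Bool) (m : ℕ) :
    Nat.count (fun i => interleaveNot g i.succPNat = b) (2 * m) = m := by
  induction m with
  | zero => rfl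
  | succ m ih =>
    rw [Nat.mul_succ, Nat.count_succ, Nat.count_succ, ih, interleaveNot_two_mul,
      interleaveNot_two_mul_add_one]
    cases g m <;> cases b <;> rfl

theorem countValues_interleaveNot (g : ℕ → Bool) (b : Bool) {k : ℕ} (hk : 1 ≤ k) :
    countValues (interleaveNot g) b (2 ^ k) = 2 ^ (k - 1) := by
  rw [countValues_eq_count, PNat.pow_coe, ← Nat.sub_add_cancel hk, pow_succ']
  exact count_interleaveNot g b _

theorem exists_not_computable_bool : ∃ g : ℕ → Bool, ¬ Computable g := by
  classical
  refine ⟨fun n => decide ((Nat.Partrec.Code.eval (Denumerable.ofNat Nat.Partrec.Code n) 0).Dom),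
    fun hg => ComputablePred.halting_problem 0 <| ComputablePred.computable_iff.2
      ⟨_, hg.comp Computable.encode, funext fun c => ?_⟩⟩
  rw [Denumerable.ofNat_encode, decide_eq_true_eq]

theorem exists_isAdmissible : ∃ f : ℕ+ → Bool, IsAdmissible f := by
  obtain ⟨g, hg⟩ := exists_not_computable_bool
  let g' : ℕ → Bool
    | 0 => true
    | n + 1 => g n
  refine ⟨interleaveNot g', fun hf => hg ?_, rfl, fun k hk => ?_⟩
  · have hindex : Computable fun n : ℕ => (2 * (n + 1)).succPNat :=
      (Computable.ofNat ℕ+).comp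
        (Primrec.nat_mul.comp (Primrec.const 2) Primrec.succ).to_comp
    exact (hf.comp hindex).of_eq fun n => interleaveNot_two_mul g' (n + 1)
  · rw [countValues_interleaveNot g' true hk, countValues_interleaveNot g' false hk]

end TheoryCombination

theorem mainTheorem7_general (f : ℕ+ → Bool) (hf : ¬ Computable f) :
    TheoryCombination.IsDecidable (TheoryCombination.Tf f) ∧
    TheoryCombination.IsDecidable TheoryCombination.Teq ∧
    TheoryCombination.HasFiniteModelProperty TheoryCombination.Teq ∧
    TheoryCombination.HasComputableMinimalModelFunction TheoryCombination.Teq ∧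
    ¬ TheoryCombination.IsSmooth TheoryCombination.Teq ∧
    ¬ TheoryCombination.IsDecidable
        (TheoryCombination.combine (TheoryCombination.Tf f) TheoryCombination.Teq) :=
  ⟨TheoryCombination.isDecidable_Tf f, TheoryCombination.isDecidable_Teq,
    TheoryCombination.hasSmallModels_Teq.hasFiniteModelProperty,
    TheoryCombination.hasComputableMinimalModelFunction_Teq, TheoryCombination.not_isSmooth_Teq,
    fun h => hf (TheoryCombination.computable_of_isDecidable_combine h)⟩

theorem mainTheorem7 :
    (∃ f : ℕ+ → Bool, TheoryCombination.IsAdmissible f) ∧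
    ∀ f : ℕ+ → Bool, TheoryCombination.IsAdmissible f →
      TheoryCombination.IsDecidable (TheoryCombination.Tf f) ∧
      TheoryCombination.IsDecidable TheoryCombination.Teq ∧
      TheoryCombination.HasFiniteModelProperty TheoryCombination.Teq ∧
      TheoryCombination.HasComputableMinimalModelFunction TheoryCombination.Teq ∧
      ¬ TheoryCombination.IsSmooth TheoryCombination.Teq ∧
      ¬ TheoryCombination.IsDecidable
          (TheoryCombination.combine (TheoryCombination.Tf f) TheoryCombination.Teq) :=
  ⟨TheoryCombination.exists_isAdmissible, fun f hf => mainTheorem7_general f hf.1⟩
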